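/- Let $n\ge 2$, $p>1$, $R>0$. Let $u_0\in C^2(\mathbf R^n)$ and $u_1\in C^1(\mathbf R^n)$ be nonnegative, neither of them identically zero, with supports in $\{|x|\le R\}$. (i) Let $\alpha\ge 1$, $\mu\ge 0$. For $\varepsilon>0$ consider the Cauchy problem $$u_{tt}-t^{-2\alpha}\Delta u+\frac{\mu}{t}u_t=|u|^p\quad (t>1,\ x\in\mathbf R^n),\qquad u(1,\cdot)=\varepsilon u_0,\quad u_t(1,\cdot)=\varepsilon u_1 .$$ A classical solution on $[1,T)$, where $1<T\le\infty$, is a function $u\in C^2([1,T)\times\mathbf R^n)$ that satisfies the equation for $1<t<T$ and the initial conditions. The lifespan $T_\varepsilon$ is the supremum of those $T$ for which there is a classical solution on $[1,T)$. Then, for every $\varepsilon>0$, every classical solution on some $[1,T)$ has $T<\infty$, and moreover $T_\varepsilon<\infty$. Furthermore there is $\varepsilon_0>0$ such that: - if $\alpha=1$, then for every $T_0>1$ there is a constant $C>0$, independent of $\varepsilon$, such that for every $0<\varepsilon\le\varepsilon_0$ with $T_\varepsilon\ge T_0$, $$T_\varepsilon^{2}(\ln T_\varepsilon)^{-n(p-1)}\le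 C\varepsilon^{-(p-1)};$$ - if $\alpha>1$, then there is a constant $C>0$, independent of $\varepsilon$, such that for every $0<\varepsilon\le\varepsilon_0$ (for which some classical solution exists) $$T_\varepsilon\le C\varepsilon^{-(p-1)/2}.$$ Here $\varepsilon_0$ and $C$ may depend on $n,p,\alpha,\mu,R,u_0,u_1$, and for $\alpha=1$ the constant $C$ also on $T_0$. (ii) Let $-1<w\le \frac2n-1$ and consider, with the same initial conditions, the semilinear wave equation in the flat Friedmann–Lemaître–Robertson–Walker spacetime $$u_{tt}-t^{-4/(n(1+w))}\Delta u+\frac{2}{(1+w)t}u_t=|u|^p\quad (t>1,\ x\in\mathbf R^n).$$ With classical solutions and the lifespan $T_\varepsilon$ defined as in (i), all the conclusions of (i) hold (with $w$ in place of $\alpha,\mu$), where the estimate for $\alpha=1$ holds if $w=\frac2n-1$ and the estimate for $\alpha>1$ holds if $-1<w<\frac2n-1$. -/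

import Mathlib

open scoped Laplacian

/-- `u` is a classical solution on `[1, T) × ℝⁿ`, where `1 < T ≤ ∞`, of the Cauchy problem
`u_tt - k(t) Δu + d(t) u_t = |u|^p` for `1 < t < T`, with data `u(1,·) = f`, `u_t(1,·) = g`.
The function `u` is of class `C²` on `[1, T) × ℝⁿ`, up to the initial time; the values `u t x`
for `t` outside `[1, T)` are irrelevant. -/
structure IsClassicalSolution {n : ℕ} (k d : ℝ → ℝ) (p : ℝ)
    (f g : EuclideanSpace ℝ (Fin n) → ℝ) (T : EReal)
    (u : ℝ → EuclideanSpace ℝ (Fin n) → ℝ) : Prop where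
  one_lt : 1 < T
  contDiffOn : ContDiffOn ℝ 2 (fun z : ℝ × EuclideanSpace ℝ (Fin n) => u z.1 z.2)
    ({t : ℝ | 1 ≤ t ∧ (t : EReal) < T} ×ˢ Set.univ)
  equation : ∀ t : ℝ, 1 < t → (t : EReal) < T → ∀ x,
    iteratedDeriv 2 (fun s => u s x) t - k t * (Δ (u t)) x + d t * deriv (fun s => u s x) t
      = |u t x| ^ p
  initial_value : ∀ x, u 1 x = f x
  /-- the one-sided time derivative at the initial time -/
  initial_velocity : ∀ x, HasDerivWithinAt (fun s => u s x) (g x) (Set.Ici 1) 1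

/-- `u` is a classical solution on `[1, T) × ℝⁿ` of `u_tt - t^{-2α} Δu + (μ/t) u_t = |u|^p`
with data `ε u₀`, `ε u₁` at `t = 1`. -/
def IsPowerSolution {n : ℕ} (α μ p ε : ℝ) (u₀ u₁ : EuclideanSpace ℝ (Fin n) → ℝ)
    (T : EReal) (u : ℝ → EuclideanSpace ℝ (Fin n) → ℝ) : Prop :=
  IsClassicalSolution (fun t => 1 / t ^ (2 * α)) (fun t => μ / t) p
    (fun x => ε * u₀ x) (fun x => ε * u₁ x) T u

/-- `u` is a classical solution on `[1, T) × ℝⁿ` of the semilinear wave equation in the flat FLRW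
spacetime, `u_tt - t^{-4/(n(1+w))} Δu + (2/((1+w)t)) u_t = |u|^p`,
with data `ε u₀`, `ε u₁` at `t = 1`. -/
def IsFLRWSolution {n : ℕ} (w p ε : ℝ) (u₀ u₁ : EuclideanSpace ℝ (Fin n) → ℝ)
    (T : EReal) (u : ℝ → EuclideanSpace ℝ (Fin n) → ℝ) : Prop :=
  IsClassicalSolution (fun t => 1 / t ^ (4 / (n * (1 + w)))) (fun t => 2 / ((1 + w) * t)) p
    (fun x => ε * u₀ x) (fun x => ε * u₁ x) T u

/-- The lifespan: the supremum, in the extended reals, of the times `T` for which there is a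
solution on `[1, T) × ℝⁿ`; here `Sol T u` says that `u` is such a solution. -/
noncomputable def lifespan {n : ℕ}
    (Sol : EReal → (ℝ → EuclideanSpace ℝ (Fin n) → ℝ) → Prop) : EReal :=
  sSup {T : EReal | ∃ u, Sol T u}

open MeasureTheory Set Filter Topology

/-! The spatial integral `U(t) = ∫ u(t,x) dx` obeys a differential inequality that forces blow-up.
Integrating the equation removes the Laplacian and leaves `U'' + (μ/t) U' = ∫ |u|^p`. Waves travel
at speed `t^(-α)`, so `u(t,·)` lives in the ball of radius `R + A(t)`, where `A(t)` is the integral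
of `s^(-α)` from `1` to `t`. By Jensen the right side is at least `V(t)^(1-p) U^p`, with `V(t)` the
volume of that ball (`IsPowerSolution.exists_mean`). Since `(t^μ U')' ≥ 0` and the data are
nonnegative, `U` never falls below `ε ∫ u₀ > 0`.

On a dyadic interval `[a, 2a]` the damping costs at most a factor `2^μ`, and `V(t)` may be replaced
by its bound at `2a`. There `U` keeps doubling, in times that shrink geometrically, so it would
become infinite before `2a` unless `V^(1-p) (ε ∫ u₀)^(p-1) a²` is bounded
(`mul_rpow_mul_sq_le_of_deriv2_add_div_mul_deriv_ge`). With `a = s/2` this gives `s² ≤ C (R +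
A(s))^(n(p-1)) ε^(-(p-1))` for every `s > 2` below the lifespan (`sq_le_of_lt_lifespan`). For `α >
1` the radius is bounded; for `α = 1` it grows like `log s`. The FLRW equation is the special case
`α = 2/(n(1+w))`, `μ = 2/(1+w)`.

The support property (`eq_zero_of_add_lt_norm`) is a local energy estimate in a shrinking backward
cone: a weight vanishing at the lateral boundary replaces the surface terms, and the shrinking of
the cone pays for the energy flux. -/

/-! ### Integrals of compactly supported functions, Gronwall and Jensen. -/

theorem ContinuousOn.slice {X Y Z : Type*} [TopologicalSpace X] [TopologicalSpace Y]
    [TopologicalSpace Z] {G : X → Y → Z} {I : Set X}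
    (hG : ContinuousOn (fun z : X × Y => G z.1 z.2) (I ×ˢ univ)) {t : X} (ht : t ∈ I) :
    Continuous (G t) :=
  hG.comp_continuous (f := fun y : Y => (t, y)) (by fun_prop) fun _ => ⟨ht, mem_univ _⟩

/-- Differentiation under the integral sign for integrands supported in a fixed compact set. -/
theorem hasDerivAt_integral_of_compact_support {E : Type*} [NormedAddCommGroup E]
    [MeasurableSpace E] [BorelSpace E] {ν : Measure E} [IsFiniteMeasureOnCompacts ν]
    {F F' : ℝ → E → ℝ} {a b t : ℝ} (ht : t ∈ Ioo a b) {K : Set E} (hK : IsCompact K)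
    (hF : ContinuousOn (fun z : ℝ × E => F z.1 z.2) (Ioo a b ×ˢ univ))
    (hF' : ContinuousOn (fun z : ℝ × E => F' z.1 z.2) (Ioo a b ×ˢ univ))
    (hd : ∀ s ∈ Ioo a b, ∀ x, HasDerivAt (fun r => F r x) (F' s x) s)
    (h0 : ∀ s ∈ Ioo a b, ∀ x, x ∉ K → F s x = 0) :
    HasDerivAt (fun s => ∫ x, F s x ∂ν) (∫ x, F' t x ∂ν) t := by
  have h0' : ∀ s ∈ Ioo a b, ∀ x, x ∉ K → F' s x = 0 := by
    intro s hs x hx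
    have h1 : (fun r => F r x) =ᶠ[𝓝 s] fun _ => 0 := by
      filter_upwards [Ioo_mem_nhds hs.1 hs.2] with r hr using h0 r hr x hx
    exact (hd s hs x).unique ((hasDerivAt_const s (0 : ℝ)).congr_of_eventuallyEq h1)
  obtain ⟨c, hc, hct⟩ := exists_between ht.1
  obtain ⟨d, htd, hd'⟩ := exists_between ht.2
  have hsub : Icc c d ⊆ Ioo a b := fun r hr => ⟨hc.trans_le hr.1, hr.2.trans_lt hd'⟩
  obtain ⟨M, hM⟩ := ((isCompact_Icc (a := c) (b := d)).prod hK).exists_bound_of_continuousOn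
    (hF'.mono (prod_mono hsub (subset_univ _)))
  have hcs : ∀ {G : ℝ → E → ℝ}, ContinuousOn (fun z : ℝ × E => G z.1 z.2) (Ioo a b ×ˢ univ) →
      (∀ s ∈ Ioo a b, ∀ x, x ∉ K → G s x = 0) → ∀ s ∈ Ioo a b, Integrable (G s) ν :=
    fun hG hG0 s hs => (hG.slice hs).integrable_of_hasCompactSupport
      (HasCompactSupport.intro hK (hG0 s hs))
  refine (hasDerivAt_integral_of_dominated_loc_of_deriv_le (s := Icc c d) (F := F) (F' := F')
    (bound := K.indicator fun _ => M) (Icc_mem_nhds hct htd) ?_ (hcs hF h0 t ht)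
    (hcs hF' h0' t ht).aestronglyMeasurable ?_ ?_ ?_).2
  · filter_upwards [Ioo_mem_nhds ht.1 ht.2] with s hs using (hcs hF h0 s hs).aestronglyMeasurable
  · refine Eventually.of_forall fun x s hs => ?_
    by_cases hx : x ∈ K
    · simpa [hx] using hM (s, x) ⟨hs, hx⟩
    · simp [hx, h0' s (hsub hs) x hx]
  · exact (integrable_indicator_iff hK.measurableSet).2 (integrableOn_const hK.measure_ne_top)
  · exact Eventually.of_forall fun x s hs => hd s (hsub hs) x

/-- The integral of a directional derivative of a compactly supported function vanishes. -/
theorem integral_hasFDerivAt_apply_eq_zero {E : Type*} [NormedAddCommGroup E] [NormedSpace ℝ E]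
    [FiniteDimensional ℝ E] [MeasurableSpace E] [BorelSpace E] {ν : Measure E}
    [ν.IsAddHaarMeasure] {f : E → ℝ} {f' : E → E →L[ℝ] ℝ} {v : E}
    (hf : ∀ x, HasFDerivAt f (f' x) x) (hf' : Continuous fun x => f' x v)
    {K : Set E} (hK : IsCompact K) (h0 : ∀ x, x ∉ K → f x = 0) :
    ∫ x, f' x v ∂ν = 0 := by
  have hfc : HasCompactSupport f := HasCompactSupport.intro hK h0
  have hcont : Continuous f := continuous_iff_continuousAt.2 fun x => (hf x).continuousAt
  have heq : f' = fderiv ℝ f := funext fun x => (hf x).fderiv.symm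
  have hint' : Integrable (fun x => f' x v) ν := by
    refine hf'.integrable_of_hasCompactSupport ?_
    have := hfc.fderiv_apply ℝ v
    rwa [← heq] at this
  have hint : Integrable f ν := hcont.integrable_of_hasCompactSupport hfc
  -- Integration by parts against the constant function `1`, whose derivative is zero.
  have := integral_bilinear_hasFDerivAt_right_eq_neg_left_of_integrable (μ := ν)
    (B := ContinuousLinearMap.mul ℝ ℝ) (f := fun _ : E => (1 : ℝ)) (f' := fun _ => 0)
    (g := f) (g' := f') (v := v) (by simp) (by simpa using hint') (by simpa using hint)
    (fun x _ => hasFDerivAt_const _ _) (fun x _ => hf x)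
  simpa using this

/-- A nonnegative function with `E' ≤ C E` that vanishes at the initial time vanishes. -/
theorem eq_zero_of_deriv_le_mul {E E' : ℝ → ℝ} {a b C : ℝ} (hab : a ≤ b)
    (hE : ContinuousOn E (Icc a b)) (hd : ∀ t ∈ Ioo a b, HasDerivAt E (E' t) t)
    (hle : ∀ t ∈ Ioo a b, E' t ≤ C * E t) (ha : E a = 0) (hb : 0 ≤ E b) : E b = 0 := by
  have hexp : ∀ t, HasDerivAt (fun t => Real.exp (-C * t)) (Real.exp (-C * t) * (-C)) t := by
    intro t
    simpa using ((hasDerivAt_id t).const_mul (-C)).exp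
  have hanti : AntitoneOn (fun t => Real.exp (-C * t) * E t) (Icc a b) := by
    refine antitoneOn_of_hasDerivWithinAt_nonpos (convex_Icc a b)
      ((by fun_prop : Continuous fun t : ℝ => Real.exp (-C * t)).continuousOn.mul hE)
      (f' := fun t => Real.exp (-C * t) * (-C) * E t + Real.exp (-C * t) * E' t) ?_ ?_
    · intro t ht
      rw [interior_Icc] at ht
      exact ((hexp t).mul (hd t ht)).hasDerivWithinAt
    · intro t ht
      rw [interior_Icc] at ht
      have := mul_le_mul_of_nonneg_left (hle t ht) (Real.exp_pos (-C * t)).le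
      nlinarith
  have h := hanti (left_mem_Icc.2 hab) (right_mem_Icc.2 hab) hab
  simp only [ha, mul_zero] at h
  have := nonpos_of_mul_nonpos_right h (Real.exp_pos _)
  exact le_antisymm this hb

/-- The graph of `y ↦ |y| ^ p` lies above its tangent at a nonnegative point. -/
theorem rpow_add_mul_sub_le_abs_rpow {p : ℝ} (hp : 1 < p) {b : ℝ} (hb : 0 ≤ b) (y : ℝ) :
    b ^ p + p * b ^ (p - 1) * (y - b) ≤ |y| ^ p := by
  rcases hb.eq_or_lt with rfl | hb
  · rw [Real.zero_rpow (by linarith), Real.zero_rpow (by linarith)]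
    simpa using Real.rpow_nonneg (abs_nonneg y) p
  -- Bernoulli's inequality with base `|y| / b`; it is multiplied by `b ^ p` below.
  · have h1 : 1 + p * (|y| / b - 1) ≤ (1 + (|y| / b - 1)) ^ p :=
      one_add_mul_self_le_rpow_one_add (by linarith [div_nonneg (abs_nonneg y) hb.le]) hp.le
    rw [add_sub_cancel, Real.div_rpow (abs_nonneg y) hb.le, le_div_iff₀ (Real.rpow_pos_of_pos hb p)]
      at h1
    have h2 : b ^ p = b ^ (p - 1) * b := by
      rw [← Real.rpow_add_one hb.ne']; simp
    have h3 : (1 + p * (|y| / b - 1)) * b ^ p = b ^ p + p * b ^ (p - 1) * (|y| - b) := by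
      rw [h2]; field_simp
    rw [h3] at h1
    refine le_trans ?_ h1
    have : 0 ≤ p * b ^ (p - 1) := by positivity
    have := mul_le_mul_of_nonneg_left (sub_le_sub_right (le_abs_self y) b) this
    linarith

/-- Jensen's inequality for a continuous function supported in a compact set. -/
theorem mul_integral_div_rpow_le {E : Type*} [NormedAddCommGroup E]
    [MeasurableSpace E] [BorelSpace E] {ν : Measure E} [IsFiniteMeasureOnCompacts ν]
    {p : ℝ} (hp : 1 < p) {f : E → ℝ} (hf : Continuous f) {K : Set E} (hK : IsCompact K)
    (hpos : 0 < ν.real K) (h0 : ∀ x, x ∉ K → f x = 0) (hint : 0 ≤ ∫ x, f x ∂ν) :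
    ν.real K * ((∫ x, f x ∂ν) / ν.real K) ^ p ≤ ∫ x, |f x| ^ p ∂ν := by
  have hfc : HasCompactSupport f := HasCompactSupport.intro hK h0
  have hi1 : Integrable f ν := hf.integrable_of_hasCompactSupport hfc
  have hi2 : Integrable (fun x => |f x| ^ p) ν := by
    refine (hf.abs.rpow_const fun x => Or.inr (by linarith)).integrable_of_hasCompactSupport
      (HasCompactSupport.intro hK fun x hx => ?_)
    rw [h0 x hx, abs_zero, Real.zero_rpow (by linarith)]
  set V := ν.real K with hV
  set b := (∫ x, f x ∂ν) / V with hbdef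
  have hb : 0 ≤ b := div_nonneg hint hpos.le
  have hic : ∀ c : ℝ, IntegrableOn (fun _ => c) K ν := fun c => integrableOn_const hK.measure_ne_top
  have e1 : ∫ x in K, f x ∂ν = V * b := by
    rw [setIntegral_eq_integral_of_forall_compl_eq_zero h0, hbdef]
    field_simp
  have e2 : ∫ x in K, |f x| ^ p ∂ν = ∫ x, |f x| ^ p ∂ν :=
    setIntegral_eq_integral_of_forall_compl_eq_zero fun x hx => by
      rw [h0 x hx, abs_zero, Real.zero_rpow (by linarith)]
  have hi3 : IntegrableOn (fun x => p * b ^ (p - 1) * (f x - b)) K ν :=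
    (hi1.integrableOn.sub (hic b)).const_mul _
  -- The tangent is taken at the mean `b`, so its linear term integrates to zero over `K`.
  have hcont : ∫ x in K, (b ^ p + p * b ^ (p - 1) * (f x - b)) ∂ν ≤ ∫ x in K, |f x| ^ p ∂ν :=
    integral_mono ((hic _).add hi3) hi2.integrableOn
      fun x => rpow_add_mul_sub_le_abs_rpow hp hb (f x)
  rw [e2, integral_add (hic _) hi3, integral_const_mul,
    integral_sub hi1.integrableOn (hic b), e1] at hcont
  simpa [← hV] using hcont

/-! ### Blow-up for the ordinary differential inequality. -/

/-- One step of the growth estimate for `U'' + (μ/t) U' ≥ κ U ^ p`. -/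
theorem add_le_of_deriv2_add_div_mul_deriv_ge {U U1 U2 : ℝ → ℝ} {μ p κ a s h m : ℝ} (hμ : 0 ≤ μ)
    (hp : 0 ≤ p) (ha : 0 < a) (hκ : 0 ≤ κ) (hm : 0 < m) (hs : a ≤ s) (hh : 0 ≤ h) (hsh : s + h ≤ 2 * a)
    (hU : ∀ t ∈ Icc a (2 * a), HasDerivAt U (U1 t) t)
    (hU1 : ∀ t ∈ Icc a (2 * a), HasDerivAt U1 (U2 t) t)
    (hineq : ∀ t ∈ Icc a (2 * a), κ * U t ^ p ≤ U2 t + μ / t * U1 t)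
    (hpos : ∀ t ∈ Icc a (2 * a), 0 ≤ U1 t) (hms : m ≤ U s) :
    m + 2 ^ (-μ) * κ * m ^ p * h ^ 2 / 2 ≤ U (s + h) := by
  have hsub : Icc s (s + h) ⊆ Icc a (2 * a) := Icc_subset_Icc hs hsh
  have hss : s ∈ Icc s (s + h) := ⟨le_rfl, by linarith⟩
  have hend : s + h ∈ Icc s (s + h) := ⟨by linarith, le_rfl⟩
  have contU : ContinuousOn U (Icc s (s + h)) := fun t ht =>
    (hU t (hsub ht)).continuousAt.continuousWithinAt
  have hint : ∀ t ∈ interior (Icc s (s + h)), t ∈ Icc a (2 * a) :=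
    fun t ht => hsub (interior_subset ht)
  have monoU : MonotoneOn U (Icc s (s + h)) :=
    monotoneOn_of_hasDerivWithinAt_nonneg (convex_Icc _ _) contU
      (fun t ht => (hU t (hint t ht)).hasDerivWithinAt) fun t ht => hpos t (hint t ht)
  have hUm : ∀ t ∈ Icc s (s + h), m ≤ U t := fun t ht => hms.trans (monoU hss ht ht.1)
  have hpow : ∀ t ∈ Icc a (2 * a), HasDerivAt (fun t => t ^ μ) (μ * t ^ (μ - 1)) t :=
    fun t ht => Real.hasDerivAt_rpow_const (Or.inl (ha.trans_le ht.1).ne')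
  -- The integrating factor `t ^ μ` absorbs the damping: `(t^μ U')' = t^μ (U'' + (μ/t) U') ≥ a^μ κ
  -- m^p`.
  have hG : ∀ t ∈ Icc a (2 * a), HasDerivAt (fun t => t ^ μ * U1 t - a ^ μ * (κ * m ^ p) * (t - s))
      (μ * t ^ (μ - 1) * U1 t + t ^ μ * U2 t - a ^ μ * (κ * m ^ p) * 1) t := fun t ht =>
    ((hpow t ht).mul (hU1 t ht)).sub (((hasDerivAt_id t).sub_const s).const_mul _)
  have monoG : MonotoneOn (fun t => t ^ μ * U1 t - a ^ μ * (κ * m ^ p) * (t - s))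
      (Icc s (s + h)) := by
    refine monotoneOn_of_hasDerivWithinAt_nonneg (convex_Icc _ _)
      (fun t ht => (hG t (hsub ht)).continuousAt.continuousWithinAt)
      (fun t ht => (hG t (hint t ht)).hasDerivWithinAt) fun t ht => ?_
    have hta := hint t ht
    have ht0 : 0 < t := ha.trans_le hta.1
    have h1 : κ * m ^ p ≤ U2 t + μ / t * U1 t := by
      refine le_trans ?_ (hineq t hta)
      gcongr
      exact hUm t (interior_subset ht)
    have h2 : a ^ μ * (κ * m ^ p) ≤ t ^ μ * (U2 t + μ / t * U1 t) := by
      have : a ^ μ ≤ t ^ μ := Real.rpow_le_rpow ha.le hta.1 hμ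
      gcongr
    rw [Real.rpow_sub_one ht0.ne']
    have h3 : t ^ μ * (U2 t + μ / t * U1 t) = μ * (t ^ μ / t) * U1 t + t ^ μ * U2 t := by ring
    linarith
  -- The factor `2 ^ (-μ)` is the least value of `(a / t) ^ μ` on `[a, 2a]`.
  have hU1low : ∀ t ∈ Icc s (s + h), 2 ^ (-μ) * (κ * m ^ p) * (t - s) ≤ U1 t := by
    intro t ht
    have hta := hsub ht
    have ht0 : 0 < t := ha.trans_le hta.1
    have h1 := monoG hss ht ht.1
    simp only [sub_self, mul_zero, sub_zero] at h1
    have h2 : 0 ≤ s ^ μ * U1 s :=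
      mul_nonneg (Real.rpow_nonneg (ha.le.trans hs) _) (hpos s (hsub hss))
    have h3 : t ^ μ ≤ 2 ^ μ * a ^ μ := by
      rw [← Real.mul_rpow (by norm_num) ha.le]
      exact Real.rpow_le_rpow ht0.le hta.2 hμ
    have h4 : a ^ μ * (κ * m ^ p) * (t - s) ≤ 2 ^ μ * a ^ μ * U1 t :=
      (by linarith : _ ≤ t ^ μ * U1 t).trans (mul_le_mul_of_nonneg_right h3 (hpos t hta))
    have ha' : 0 < a ^ μ := Real.rpow_pos_of_pos ha μ
    have h5 : κ * m ^ p * (t - s) ≤ 2 ^ μ * U1 t := by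
      refine le_of_mul_le_mul_left ?_ ha'
      linarith
    rw [Real.rpow_neg (by norm_num)]
    have h6 : (0 : ℝ) < 2 ^ μ := by positivity
    rw [mul_assoc, inv_mul_le_iff₀ h6]
    exact h5
  have hH : ∀ t ∈ Icc a (2 * a), HasDerivAt
      (fun t => U t - 2 ^ (-μ) * (κ * m ^ p) / 2 * (t - s) ^ 2)
      (U1 t - 2 ^ (-μ) * (κ * m ^ p) / 2 * (2 * (t - s))) t := fun t ht => by
    have := (((hasDerivAt_id t).sub_const s).pow 2).const_mul (2 ^ (-μ) * (κ * m ^ p) / 2)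
    exact ((hU t ht).sub this).congr_deriv (by simp)
  have monoH : MonotoneOn (fun t => U t - 2 ^ (-μ) * (κ * m ^ p) / 2 * (t - s) ^ 2)
      (Icc s (s + h)) := by
    refine monotoneOn_of_hasDerivWithinAt_nonneg (convex_Icc _ _)
      (fun t ht => (hH t (hsub ht)).continuousAt.continuousWithinAt)
      (fun t ht => (hH t (hint t ht)).hasDerivWithinAt) fun t ht => ?_
    have := hU1low t (interior_subset ht)
    linarith
  have h1 := monoH hss hend (by linarith)
  simp only [sub_self, add_sub_cancel_left] at h1
  have : (0 : ℝ) ^ 2 = 0 := by norm_num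
  rw [this] at h1
  linarith

/-- If `U'' + (μ/t) U' ≥ κ U ^ p` on `[a, 2a]` with `U ≥ δ > 0` and `U' ≥ 0`, then `κ δ^(p-1) a²`
is bounded by a constant that depends only on `μ` and `p`. -/
theorem mul_rpow_mul_sq_le_of_deriv2_add_div_mul_deriv_ge {U U1 U2 : ℝ → ℝ} {μ p κ a δ : ℝ}
    (hμ : 0 ≤ μ) (hp : 1 < p) (ha : 0 < a) (hκ : 0 < κ) (hδ : 0 < δ)
    (hU : ∀ t ∈ Icc a (2 * a), HasDerivAt U (U1 t) t)
    (hU1 : ∀ t ∈ Icc a (2 * a), HasDerivAt U1 (U2 t) t)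
    (hineq : ∀ t ∈ Icc a (2 * a), κ * U t ^ p ≤ U2 t + μ / t * U1 t)
    (hpos : ∀ t ∈ Icc a (2 * a), 0 ≤ U1 t) (hδU : δ ≤ U a) :
    κ * δ ^ (p - 1) * a ^ 2 ≤ 2 ^ (μ + 1) / (1 - 2 ^ (-((p - 1) / 2))) ^ 2 := by
  by_contra! hcon
  -- Doubling from level `m` takes a time `h` with `2^(-μ) κ m^(p-1) h² / 2 = 1`. Doubling `m`
  -- multiplies this time by `r`; the value at `m = δ` is `H` below.
  set r : ℝ := 2 ^ (-((p - 1) / 2)) with hr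
  have hr0 : 0 < r := by positivity
  have hr1 : r < 1 := Real.rpow_lt_one_of_one_lt_of_neg (by norm_num) (by linarith)
  have h1r : 0 < 1 - r := by linarith
  set Q : ℝ := κ * δ ^ (p - 1) with hQ
  have hQ0 : 0 < Q := by positivity
  set H : ℝ := √(2 ^ (μ + 1) / Q) with hH
  have hH0 : 0 ≤ H := Real.sqrt_nonneg _
  have hH2 : Q * H ^ 2 = 2 ^ (μ + 1) := by
    rw [hH, Real.sq_sqrt (by positivity)]
    field_simp
  -- The negated bound says that the total doubling time `H / (1 - r)` fits into an interval of
  -- length `a`.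
  have hHa : H ≤ a * (1 - r) := by
    refine Real.sqrt_le_iff.2 ⟨by positivity, ?_⟩
    rw [div_lt_iff₀ (by positivity)] at hcon
    rw [div_le_iff₀ hQ0]
    nlinarith
  have hgeom : ∀ k : ℕ, H * ∑ i ∈ Finset.range k, r ^ i ≤ a := by
    intro k
    have h1 : (∑ i ∈ Finset.range k, r ^ i) * (1 - r) ≤ 1 := by
      rw [geom_sum_mul_neg]
      linarith [pow_pos hr0 k]
    have h2 : 0 ≤ ∑ i ∈ Finset.range k, r ^ i := Finset.sum_nonneg fun i _ => by positivity
    calc H * ∑ i ∈ Finset.range k, r ^ i ≤ a * (1 - r) * ∑ i ∈ Finset.range k, r ^ i := by gcongr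
      _ = a * ((∑ i ∈ Finset.range k, r ^ i) * (1 - r)) := by ring
      _ ≤ a * 1 := by gcongr
      _ = a := mul_one a
  have hsum0 : ∀ k : ℕ, 0 ≤ H * ∑ i ∈ Finset.range k, r ^ i := fun k =>
    mul_nonneg hH0 (Finset.sum_nonneg fun i _ => by positivity)
  have hgrow : ∀ k : ℕ, δ * 2 ^ k ≤ U (a + H * ∑ i ∈ Finset.range k, r ^ i) := by
    intro k
    induction k with
    | zero => simpa using hδU
    | succ k ih =>
      have hstep := add_le_of_deriv2_add_div_mul_deriv_ge (s := a + H * ∑ i ∈ Finset.range k, r ^ i)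
        (h := H * r ^ k) (m := δ * 2 ^ k) hμ (by linarith) ha hκ.le (by positivity)
        (by linarith [hsum0 k]) (by positivity)
        (by have := hgeom (k + 1); rw [Finset.sum_range_succ] at this; linarith) hU hU1 hineq hpos ih
      rw [Finset.sum_range_succ, mul_add, ← add_assoc]
      refine le_trans (le_of_eq ?_) hstep
      have e1 : (δ * 2 ^ k : ℝ) ^ p = δ ^ (p - 1) * δ * (2 ^ k * ((2 : ℝ) ^ k) ^ (p - 1)) := by
        rw [Real.mul_rpow hδ.le (by positivity), ← Real.rpow_add_one hδ.ne',
          ← Real.rpow_one_add' (by positivity) (by linarith)]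
        congr 2 <;> ring
      have e2 : (r ^ k) ^ 2 * ((2 : ℝ) ^ k) ^ (p - 1) = 1 := by
        rw [hr, ← Real.rpow_natCast, ← Real.rpow_natCast, ← Real.rpow_natCast, ← Real.rpow_mul,
          ← Real.rpow_mul, ← Real.rpow_mul, ← Real.rpow_add (by norm_num)] <;> try positivity
        rw [← Real.rpow_zero 2]
        congr 1
        push_cast
        ring
      have e3 : (2 : ℝ) ^ (-μ) * 2 ^ (μ + 1) = 2 := by
        rw [← Real.rpow_add (by norm_num)]; norm_num
      rw [e1]
      calc δ * 2 ^ (k + 1) = δ * 2 ^ k + δ * 2 ^ k * (2 : ℝ) / 2 * 1 := by ring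
        _ = δ * 2 ^ k + δ * 2 ^ k * (2 ^ (-μ) * (Q * H ^ 2)) / 2 *
              ((r ^ k) ^ 2 * ((2 : ℝ) ^ k) ^ (p - 1)) := by rw [e2, hH2, e3]
        _ = _ := by rw [hQ]; ring
  have contU : ContinuousOn U (Icc a (2 * a)) := fun t ht => (hU t ht).continuousAt.continuousWithinAt
  -- Arbitrarily many doublings happen inside `[a, 2a]`, where the continuous function `U` is
  -- bounded.
  obtain ⟨M, hM⟩ := isCompact_Icc.exists_bound_of_continuousOn contU
  obtain ⟨k, hk⟩ := pow_unbounded_of_one_lt (M / δ) (one_lt_two (α := ℝ))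
  have h1 := hM _ (⟨by linarith [hsum0 k], by linarith [hgeom k]⟩ :
    a + H * ∑ i ∈ Finset.range k, r ^ i ∈ Icc a (2 * a))
  have h2 := (le_abs_self _).trans h1
  rw [div_lt_iff₀ hδ] at hk
  linarith [hgrow k]

/-! ### Derivatives on the strip: first order up to `t = 1`, second order in the interior. -/

/-- The directional derivative of a space-time function on `[1, T) × E`, one-sided in time at
the initial time. -/
noncomputable def dirDeriv {E : Type*} [NormedAddCommGroup E] [NormedSpace ℝ E] (T : ℝ)
    (u : ℝ → E → ℝ) (v : ℝ × E) (t : ℝ) (x : E) : ℝ :=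
  fderivWithin ℝ (fun z : ℝ × E => u z.1 z.2) (Ico 1 T ×ˢ univ) (t, x) v

/-- The second directional derivative of a space-time function, first along `v`, then along `w`. -/
noncomputable def dirDeriv2 {E : Type*} [NormedAddCommGroup E] [NormedSpace ℝ E]
    (u : ℝ → E → ℝ) (v w : ℝ × E) (t : ℝ) (x : E) : ℝ :=
  fderiv ℝ (fderiv ℝ (fun z : ℝ × E => u z.1 z.2)) (t, x) w v

theorem strip_mem_nhds {E : Type*} [NormedAddCommGroup E] {T t : ℝ} (ht : t ∈ Ioo 1 T) (x : E) :
    (Ico 1 T ×ˢ univ : Set (ℝ × E)) ∈ 𝓝 (t, x) :=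
  prod_mem_nhds (Ico_mem_nhds ht.1 ht.2) univ_mem

theorem isOpen_strip_interior {E : Type*} [NormedAddCommGroup E] {T : ℝ} :
    IsOpen (Ioo 1 T ×ˢ univ : Set (ℝ × E)) :=
  isOpen_Ioo.prod isOpen_univ

section Strip

variable {E : Type*} [NormedAddCommGroup E] [NormedSpace ℝ E] {T : ℝ} {u : ℝ → E → ℝ}

theorem uniqueDiffOn_strip : UniqueDiffOn ℝ (Ico 1 T ×ˢ univ : Set (ℝ × E)) :=
  (uniqueDiffOn_Ico 1 T).prod uniqueDiffOn_univ

theorem continuousOn_dirDeriv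
    (hu : ContDiffOn ℝ 2 (fun z : ℝ × E => u z.1 z.2) (Ico 1 T ×ˢ univ)) (v : ℝ × E) :
    ContinuousOn (fun z : ℝ × E => dirDeriv T u v z.1 z.2) (Ico 1 T ×ˢ univ) :=
  (hu.continuousOn_fderivWithin uniqueDiffOn_strip (by norm_num)).clm_apply
    continuousOn_const

theorem hasFDerivWithinAt_strip
    (hu : ContDiffOn ℝ 2 (fun z : ℝ × E => u z.1 z.2) (Ico 1 T ×ˢ univ)) {t : ℝ}
    (ht : t ∈ Ico 1 T) (x : E) :
    HasFDerivWithinAt (fun z : ℝ × E => u z.1 z.2)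
      (fderivWithin ℝ (fun z : ℝ × E => u z.1 z.2) (Ico 1 T ×ˢ univ) (t, x))
      (Ico 1 T ×ˢ univ) (t, x) :=
  (hu.differentiableOn (by norm_num) (t, x) ⟨ht, mem_univ _⟩).hasFDerivWithinAt

theorem hasDerivWithinAt_prodMk_left (t : ℝ) (x : E) (s : Set ℝ) :
    HasDerivWithinAt (fun r : ℝ => (r, x)) ((1 : ℝ), (0 : E)) s t :=
  (hasDerivWithinAt_id t s).prodMk (hasDerivWithinAt_const t s x)

theorem hasDerivWithinAt_dirDeriv_time
    (hu : ContDiffOn ℝ 2 (fun z : ℝ × E => u z.1 z.2) (Ico 1 T ×ˢ univ)) {t : ℝ}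
    (ht : t ∈ Ico 1 T) (x : E) :
    HasDerivWithinAt (fun s => u s x) (dirDeriv T u (1, 0) t x) (Ico 1 T) t := by
  have hmaps : MapsTo (fun r : ℝ => (r, x)) (Ico 1 T) (Ico 1 T ×ˢ univ) :=
    fun _ hs => ⟨hs, mem_univ _⟩
  exact (hasFDerivWithinAt_strip hu ht x).comp_hasDerivWithinAt t
    (hasDerivWithinAt_prodMk_left t x _) hmaps

theorem hasDerivAt_dirDeriv_time
    (hu : ContDiffOn ℝ 2 (fun z : ℝ × E => u z.1 z.2) (Ico 1 T ×ˢ univ)) {t : ℝ}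
    (ht : t ∈ Ioo 1 T) (x : E) :
    HasDerivAt (fun s => u s x) (dirDeriv T u (1, 0) t x) t :=
  (hasDerivWithinAt_dirDeriv_time hu ⟨ht.1.le, ht.2⟩ x).hasDerivAt (Ico_mem_nhds ht.1 ht.2)

theorem hasFDerivAt_dirDeriv_space
    (hu : ContDiffOn ℝ 2 (fun z : ℝ × E => u z.1 z.2) (Ico 1 T ×ˢ univ)) {t : ℝ}
    (ht : t ∈ Ico 1 T) (x : E) :
    HasFDerivAt (u t)
      ((fderivWithin ℝ (fun z : ℝ × E => u z.1 z.2) (Ico 1 T ×ˢ univ) (t, x)).comp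
        (ContinuousLinearMap.inr ℝ ℝ E)) x := by
  rw [← hasFDerivWithinAt_univ]
  exact (hasFDerivWithinAt_strip hu ht x).comp x
    (hasFDerivAt_prodMk_right t x).hasFDerivWithinAt fun _ _ => ⟨ht, mem_univ _⟩

theorem fderiv_apply_eq_dirDeriv
    (hu : ContDiffOn ℝ 2 (fun z : ℝ × E => u z.1 z.2) (Ico 1 T ×ˢ univ)) {t : ℝ}
    (ht : t ∈ Ico 1 T) (x e : E) : fderiv ℝ (u t) x e = dirDeriv T u (0, e) t x := by
  rw [(hasFDerivAt_dirDeriv_space hu ht x).fderiv]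
  rfl

theorem contDiffOn_two_interior
    (hu : ContDiffOn ℝ 2 (fun z : ℝ × E => u z.1 z.2) (Ico 1 T ×ˢ univ)) :
    ContDiffOn ℝ 2 (fun z : ℝ × E => u z.1 z.2) (Ioo 1 T ×ˢ univ) :=
  hu.mono (prod_mono Ioo_subset_Ico_self subset_rfl)

theorem contDiffOn_fderiv_interior
    (hu : ContDiffOn ℝ 2 (fun z : ℝ × E => u z.1 z.2) (Ico 1 T ×ˢ univ)) :
    ContDiffOn ℝ 1 (fderiv ℝ (fun z : ℝ × E => u z.1 z.2)) (Ioo 1 T ×ˢ univ) :=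
  (contDiffOn_two_interior hu).fderiv_of_isOpen isOpen_strip_interior (by norm_num)

theorem continuousOn_dirDeriv2
    (hu : ContDiffOn ℝ 2 (fun z : ℝ × E => u z.1 z.2) (Ico 1 T ×ˢ univ)) (v w : ℝ × E) :
    ContinuousOn (fun z : ℝ × E => dirDeriv2 u v w z.1 z.2) (Ioo 1 T ×ˢ univ) :=
  (((contDiffOn_fderiv_interior hu).continuousOn_fderiv_of_isOpen isOpen_strip_interior
    le_rfl).clm_apply continuousOn_const).clm_apply continuousOn_const

theorem hasFDerivAt_dirDeriv
    (hu : ContDiffOn ℝ 2 (fun z : ℝ × E => u z.1 z.2) (Ico 1 T ×ˢ univ)) (v : ℝ × E) {t : ℝ}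
    (ht : t ∈ Ioo 1 T) (x : E) :
    HasFDerivAt (fun z : ℝ × E => dirDeriv T u v z.1 z.2)
      ((fderiv ℝ (fderiv ℝ (fun z : ℝ × E => u z.1 z.2)) (t, x)).flip v) (t, x) := by
  have hmem : (Ioo 1 T ×ˢ univ : Set (ℝ × E)) ∈ 𝓝 (t, x) :=
    isOpen_strip_interior.mem_nhds ⟨ht, mem_univ _⟩
  have h1 := (((contDiffOn_fderiv_interior hu).differentiableOn (by norm_num)).differentiableAt
    hmem).hasFDerivAt.clm_apply (hasFDerivAt_const v (t, x))
  refine (h1.congr_of_eventuallyEq ?_).congr_fderiv (by ext <;> simp)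
  filter_upwards [hmem] with z hz
  rw [dirDeriv, fderivWithin_of_mem_nhds (strip_mem_nhds hz.1 z.2)]

theorem hasDerivAt_dirDeriv2_time
    (hu : ContDiffOn ℝ 2 (fun z : ℝ × E => u z.1 z.2) (Ico 1 T ×ˢ univ)) (v : ℝ × E) {t : ℝ}
    (ht : t ∈ Ioo 1 T) (x : E) :
    HasDerivAt (fun s => dirDeriv T u v s x) (dirDeriv2 u v (1, 0) t x) t := by
  rw [← hasDerivWithinAt_univ]
  exact (hasFDerivAt_dirDeriv hu v ht x).comp_hasDerivWithinAt t
    (hasDerivWithinAt_prodMk_left t x _)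

theorem hasFDerivAt_dirDeriv2_space
    (hu : ContDiffOn ℝ 2 (fun z : ℝ × E => u z.1 z.2) (Ico 1 T ×ˢ univ)) (v : ℝ × E) {t : ℝ}
    (ht : t ∈ Ioo 1 T) (x : E) :
    HasFDerivAt (fun y => dirDeriv T u v t y)
      (((fderiv ℝ (fderiv ℝ (fun z : ℝ × E => u z.1 z.2)) (t, x)).flip v).comp
        (ContinuousLinearMap.inr ℝ ℝ E)) x :=
  (hasFDerivAt_dirDeriv hu v ht x).comp x (hasFDerivAt_prodMk_right t x)

theorem dirDeriv2_comm
    (hu : ContDiffOn ℝ 2 (fun z : ℝ × E => u z.1 z.2) (Ico 1 T ×ˢ univ)) (v w : ℝ × E) {t : ℝ}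
    (ht : t ∈ Ioo 1 T) (x : E) : dirDeriv2 u v w t x = dirDeriv2 u w v t x :=
  ((hu.contDiffAt (strip_mem_nhds ht x)).isSymmSndFDerivAt (by simp)) w v

theorem iteratedDeriv_two_eq_dirDeriv2
    (hu : ContDiffOn ℝ 2 (fun z : ℝ × E => u z.1 z.2) (Ico 1 T ×ˢ univ)) {t : ℝ}
    (ht : t ∈ Ioo 1 T) (x : E) :
    iteratedDeriv 2 (fun s => u s x) t = dirDeriv2 u (1, 0) (1, 0) t x := by
  rw [iteratedDeriv_succ, iteratedDeriv_one]
  refine HasDerivAt.deriv ((hasDerivAt_dirDeriv2_time hu _ ht x).congr_of_eventuallyEq ?_)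
  filter_upwards [Ioo_mem_nhds ht.1 ht.2] with s hs using (hasDerivAt_dirDeriv_time hu hs x).deriv

end Strip

theorem laplacian_eq_sum_dirDeriv2 {E ι : Type*} [NormedAddCommGroup E] [InnerProductSpace ℝ E]
    [FiniteDimensional ℝ E] [Fintype ι] (b : OrthonormalBasis ι ℝ E) {T : ℝ} {u : ℝ → E → ℝ}
    (hu : ContDiffOn ℝ 2 (fun z : ℝ × E => u z.1 z.2) (Ico 1 T ×ˢ univ)) {t : ℝ}
    (ht : t ∈ Ioo 1 T) (x : E) :
    (Δ (u t)) x = ∑ i, dirDeriv2 u (0, b i) (0, b i) t x := by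
  have ht' : t ∈ Ico 1 T := Ioo_subset_Ico_self ht
  have hsm : ContDiff ℝ 2 (u t) := by
    rw [← contDiffOn_univ]
    exact hu.comp (f := fun y : E => (t, y)) (by fun_prop) fun y _ => ⟨ht', mem_univ _⟩
  rw [InnerProductSpace.laplacian_eq_iteratedFDeriv_orthonormalBasis (u t) b]
  refine Finset.sum_congr rfl fun i _ => ?_
  rw [iteratedFDeriv_two_apply]
  have hd : DifferentiableAt ℝ (fderiv ℝ (u t)) x :=
    (hsm.fderiv_right (m := 1) (by norm_num)).differentiable (by norm_num) x
  have h1 : HasFDerivAt (fun y => fderiv ℝ (u t) y (b i)) _ x :=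
    hd.hasFDerivAt.clm_apply (hasFDerivAt_const (b i) x)
  have h2 : (fun y => fderiv ℝ (u t) y (b i)) = fun y => dirDeriv T u (0, b i) t y :=
    funext fun y => fderiv_apply_eq_dirDeriv hu ht' y (b i)
  rw [h2] at h1
  have h3 := DFunLike.congr_fun (h1.unique (hasFDerivAt_dirDeriv2_space hu (0, b i) ht x)) (b i)
  simpa [dirDeriv2] using h3

/-! ### Finite speed of propagation by a weighted cone energy. -/

/-- Squaring removes the kink of the positive part, since the square is `O(r²)` at the origin. This
makes the cone weight differentiable across the boundary of the cone. -/
theorem hasDerivAt_max_zero_sq (s : ℝ) :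
    HasDerivAt (fun r : ℝ => max r 0 ^ 2) (2 * max s 0) s := by
  rcases lt_trichotomy s 0 with hs | rfl | hs
  · rw [max_eq_right hs.le, mul_zero]
    refine (hasDerivAt_const s (0 : ℝ)).congr_of_eventuallyEq ?_
    filter_upwards [Iio_mem_nhds hs] with r hr
    simp [max_eq_right (mem_Iio.1 hr).le]
  · rw [max_self, mul_zero, hasDerivAt_iff_isLittleO]
    simp only [max_self, sub_zero, smul_zero]
    refine Asymptotics.IsBigO.trans_isLittleO (g := fun r : ℝ => r ^ 2) ?_ ?_
    · refine Asymptotics.IsBigO.of_bound 1 (Eventually.of_forall fun r => ?_)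
      rcases le_total r 0 with h | h
      · simp [max_eq_right h, sq_nonneg]
      · simp [max_eq_left h]
    · simpa using Asymptotics.isLittleO_pow_id (𝕜 := ℝ) (n := 2) (by norm_num)
  · rw [max_eq_left hs.le]
    refine HasDerivAt.congr_of_eventuallyEq (by simpa using hasDerivAt_pow 2 s) ?_
    filter_upwards [Ioi_mem_nhds hs] with r hr
    simp [max_eq_left (mem_Ioi.1 hr).le]

section Cone

variable {E : Type*} [NormedAddCommGroup E]

/-- A `C¹` weight that is positive exactly in the ball of radius `ρ` about `x₀`. -/
noncomputable def coneWeight (ρ : ℝ) (x₀ x : E) : ℝ := max (ρ ^ 2 - ‖x - x₀‖ ^ 2) 0 ^ 2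

theorem coneWeight_eq_zero {ρ : ℝ} (hρ : 0 ≤ ρ) {x₀ x : E} (hx : ρ ≤ ‖x - x₀‖) :
    coneWeight ρ x₀ x = 0 := by
  rw [coneWeight, max_eq_right (by nlinarith)]
  norm_num

theorem coneWeight_self {ρ : ℝ} (hρ : 0 < ρ) (x₀ : E) : 0 < coneWeight ρ x₀ x₀ := by
  simp only [coneWeight, sub_self, norm_zero]
  have : 0 < ρ ^ 2 := by positivity
  rw [max_eq_left (by linarith)]
  norm_num
  positivity

theorem hasDerivAt_coneWeight_radius {ρ : ℝ → ℝ} {ρ' t : ℝ} (h : HasDerivAt ρ ρ' t) (x₀ x : E) :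
    HasDerivAt (fun s => coneWeight (ρ s) x₀ x)
      (2 * max (ρ t ^ 2 - ‖x - x₀‖ ^ 2) 0 * (2 * ρ t * ρ')) t := by
  have h1 : HasDerivAt (fun s => ρ s ^ 2 - ‖x - x₀‖ ^ 2) (2 * ρ t * ρ') t := by
    simpa using (h.pow 2).sub_const (‖x - x₀‖ ^ 2)
  exact (hasDerivAt_max_zero_sq _).comp t h1

theorem hasFDerivAt_coneWeight [InnerProductSpace ℝ E] (ρ : ℝ) (x₀ x : E) :
    HasFDerivAt (coneWeight ρ x₀)
      ((2 * max (ρ ^ 2 - ‖x - x₀‖ ^ 2) 0) • (-(2 • innerSL ℝ (x - x₀)) : E →L[ℝ] ℝ)) x := by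
  have h1 : HasFDerivAt (fun y => ρ ^ 2 - ‖y - x₀‖ ^ 2)
      (-(2 • innerSL ℝ (x - x₀)) : E →L[ℝ] ℝ) x := by
    have h2 := ((hasFDerivAt_id (𝕜 := ℝ) x).sub_const x₀).norm_sq
    exact (h2.const_sub (ρ ^ 2)).congr_fderiv (by ext; simp)
  exact (hasDerivAt_max_zero_sq _).comp_hasFDerivAt x h1

end Cone

/-- The divergence theorem for the flux `u_t ∇u`, localised by the cone weight. -/
theorem integral_coneWeight_flux_eq_zero {E : Type*} [NormedAddCommGroup E]
    [InnerProductSpace ℝ E] [FiniteDimensional ℝ E] [MeasurableSpace E] [BorelSpace E]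
    {T : ℝ} {u : ℝ → E → ℝ}
    (hu : ContDiffOn ℝ 2 (fun z : ℝ × E => u z.1 z.2) (Ico 1 T ×ˢ univ)) {t : ℝ}
    (ht : t ∈ Ioo 1 T) {ρ : ℝ} (hρ : 0 ≤ ρ) (x₀ e : E) :
    Continuous (fun x => -(4 * max (ρ ^ 2 - ‖x - x₀‖ ^ 2) 0 * inner ℝ (x - x₀) e *
        (dirDeriv T u (1, 0) t x * dirDeriv T u (0, e) t x)) +
      coneWeight ρ x₀ x * (dirDeriv2 u (1, 0) (0, e) t x * dirDeriv T u (0, e) t x +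
        dirDeriv T u (1, 0) t x * dirDeriv2 u (0, e) (0, e) t x)) ∧
    ∫ x, (-(4 * max (ρ ^ 2 - ‖x - x₀‖ ^ 2) 0 * inner ℝ (x - x₀) e *
        (dirDeriv T u (1, 0) t x * dirDeriv T u (0, e) t x)) +
      coneWeight ρ x₀ x * (dirDeriv2 u (1, 0) (0, e) t x * dirDeriv T u (0, e) t x +
        dirDeriv T u (1, 0) t x * dirDeriv2 u (0, e) (0, e) t x)) = 0 := by
  have ht' : t ∈ Ico 1 T := Ioo_subset_Ico_self ht
  have c1 := (continuousOn_dirDeriv hu (1, 0)).slice ht'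
  have c2 := (continuousOn_dirDeriv hu (0, e)).slice ht'
  have c3 := (continuousOn_dirDeriv2 hu (1, 0) (0, e)).slice ht
  have c4 := (continuousOn_dirDeriv2 hu (0, e) (0, e)).slice ht
  have hcont : Continuous (fun x => -(4 * max (ρ ^ 2 - ‖x - x₀‖ ^ 2) 0 * inner ℝ (x - x₀) e *
        (dirDeriv T u (1, 0) t x * dirDeriv T u (0, e) t x)) +
      coneWeight ρ x₀ x * (dirDeriv2 u (1, 0) (0, e) t x * dirDeriv T u (0, e) t x +
        dirDeriv T u (1, 0) t x * dirDeriv2 u (0, e) (0, e) t x)) := by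
    unfold coneWeight
    fun_prop
  refine ⟨hcont, ?_⟩
  -- The integrand is the derivative along `e` of weight times `u_t` times `∂_e u`, which vanishes
  -- outside a ball.
  have hd : ∀ x, HasFDerivAt (fun x => coneWeight ρ x₀ x *
      (dirDeriv T u (1, 0) t x * dirDeriv T u (0, e) t x)) _ x := fun x =>
    (hasFDerivAt_coneWeight ρ x₀ x).mul ((hasFDerivAt_dirDeriv2_space hu (1, 0) ht x).mul
      (hasFDerivAt_dirDeriv2_space hu (0, e) ht x))
  have heq : ∀ x, (-(4 * max (ρ ^ 2 - ‖x - x₀‖ ^ 2) 0 * inner ℝ (x - x₀) e *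
        (dirDeriv T u (1, 0) t x * dirDeriv T u (0, e) t x)) +
      coneWeight ρ x₀ x * (dirDeriv2 u (1, 0) (0, e) t x * dirDeriv T u (0, e) t x +
        dirDeriv T u (1, 0) t x * dirDeriv2 u (0, e) (0, e) t x)) =
      fderiv ℝ (fun x => coneWeight ρ x₀ x *
        (dirDeriv T u (1, 0) t x * dirDeriv T u (0, e) t x)) x e := by
    intro x
    rw [(hd x).fderiv]
    simp [dirDeriv2, inner_sub_left]
    ring
  simp_rw [heq] at hcont ⊢
  refine integral_hasFDerivAt_apply_eq_zero (fun x => (hd x).differentiableAt.hasFDerivAt) hcont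
    (isCompact_closedBall x₀ ρ) fun x hx => ?_
  rw [coneWeight_eq_zero hρ, zero_mul]
  rw [Metric.mem_closedBall, dist_eq_norm, not_le] at hx
  exact hx.le

/-- The pointwise inequality behind the energy estimate: in the interior of the cone the boundary
flux is dominated by the loss of energy through the shrinking of the cone. -/
theorem flux_le_of_sq_le {χ ρ a v G S u : ℝ} (hχ : 0 ≤ χ) (hρ : 0 ≤ ρ) (ha : 0 ≤ a) (hG : 0 ≤ G)
    (hS : 0 < χ → S ^ 2 ≤ ρ ^ 2 * G) :
    2 * χ * (2 * ρ * -a) * (v ^ 2 + a ^ 2 * G + u ^ 2) + 2 * a ^ 2 * (4 * χ * v * S) ≤ 0 := by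
  rcases hχ.eq_or_lt with rfl | hχ
  · simp
  have h1 : |S| ≤ ρ * √G := by
    rw [← Real.sqrt_sq hρ, ← Real.sqrt_mul (sq_nonneg ρ)]
    exact Real.abs_le_sqrt (hS hχ)
  have h2 : √G ^ 2 = G := Real.sq_sqrt hG
  have h3 : v * S ≤ |v| * (ρ * √G) :=
    (le_abs_self _).trans (by rw [abs_mul]; gcongr)
  -- The arithmetic-geometric mean inequality. Its factor `a` is matched by the rate `-a` at which
  -- the cone radius shrinks.
  have h4 : 2 * a * (|v| * √G) ≤ v ^ 2 + a ^ 2 * G := by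
    nlinarith [sq_nonneg (|v| - a * √G), sq_abs v]
  have h5 : 2 * a * (v * S) ≤ ρ * (v ^ 2 + a ^ 2 * G + u ^ 2) := by
    calc 2 * a * (v * S) ≤ 2 * a * (|v| * (ρ * √G)) := by gcongr
      _ = ρ * (2 * a * (|v| * √G)) := by ring
      _ ≤ ρ * (v ^ 2 + a ^ 2 * G + u ^ 2) := by gcongr; nlinarith [sq_nonneg u]
  have h6 : 0 ≤ 4 * (χ * a) := by positivity
  nlinarith [mul_le_mul_of_nonneg_left h5 h6]

/-- Finite speed of propagation: a classical solution of `u_tt - a² Δu + d u_t = |u|^p` with `a`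
nonincreasing and `d ≥ 0`, whose data vanish for `|x| > R`, vanishes for `|x| > R + A(t)`, where
`A' = a` and `A(1) = 0`. -/
theorem eq_zero_of_add_lt_norm {E ι : Type*} [NormedAddCommGroup E]
    [InnerProductSpace ℝ E] [FiniteDimensional ℝ E] [MeasurableSpace E] [BorelSpace E]
    [Fintype ι] (b : OrthonormalBasis ι ℝ E)
    {T p R : ℝ} {u : ℝ → E → ℝ} {a a' A d : ℝ → ℝ} (hp : 1 < p)
    (hu : ContDiffOn ℝ 2 (fun z : ℝ × E => u z.1 z.2) (Ico 1 T ×ˢ univ))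
    (ha : ∀ t ∈ Ico 1 T, 0 ≤ a t) (hac : ContinuousOn a (Ico 1 T))
    (had : ∀ t ∈ Ioo 1 T, HasDerivAt a (a' t) t) (hac' : ContinuousOn a' (Ioo 1 T))
    (ha' : ∀ t ∈ Ioo 1 T, a' t ≤ 0)
    (hA : ∀ t ∈ Ico 1 T, HasDerivAt A (a t) t) (hA1 : A 1 = 0) (hd : ∀ t ∈ Ioo 1 T, 0 ≤ d t)
    (heq : ∀ t ∈ Ioo 1 T, ∀ x, dirDeriv2 u (1, 0) (1, 0) t x
      - a t ^ 2 * ∑ i, dirDeriv2 u (0, b i) (0, b i) t x + d t * dirDeriv T u (1, 0) t x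
      = |u t x| ^ p)
    (h0 : ∀ x, R < ‖x‖ → u 1 x = 0) (h1 : ∀ x, R < ‖x‖ → dirDeriv T u (1, 0) 1 x = 0)
    {τ : ℝ} (hτ : τ ∈ Ico 1 T) {x₀ : E} (hx : R + A τ < ‖x₀‖) : u τ x₀ = 0 := by
  rcases hτ.1.eq_or_lt with rfl | h1τ
  · exact h0 x₀ (by linarith)
  have sub1 : Icc 1 τ ⊆ Ico 1 T := fun t ht => ⟨ht.1, ht.2.trans_lt hτ.2⟩
  have sub2 : Ioo 1 τ ⊆ Ioo 1 T := fun t ht => ⟨ht.1, ht.2.trans hτ.2⟩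
  have sub3 : Ioo 1 τ ⊆ Icc 1 τ := Ioo_subset_Icc_self
  -- Radius of the backward cone about `x₀`: it is still positive at time `τ`, and at time `1` the
  -- open ball of this radius lies in `R < ‖x‖`, where the data vanish.
  set ρ : ℝ → ℝ := fun t => ‖x₀‖ - R - A t with hρdef
  have hAc : ContinuousOn A (Icc 1 τ) := fun t ht =>
    (hA t (sub1 ht)).continuousAt.continuousWithinAt
  have hAmono : MonotoneOn A (Icc 1 τ) :=
    monotoneOn_of_hasDerivWithinAt_nonneg (convex_Icc _ _) hAc
      (fun t ht => (hA t (sub1 (interior_subset ht))).hasDerivWithinAt)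
      fun t ht => ha t (sub1 (interior_subset ht))
  have hρpos : ∀ t ∈ Icc 1 τ, 0 < ρ t := fun t ht => by
    have := hAmono ht (right_mem_Icc.2 h1τ.le) ht.2
    simp only [hρdef]
    linarith
  have hρle : ∀ t ∈ Icc 1 τ, ρ t ≤ ρ 1 := fun t ht => by
    have := hAmono (left_mem_Icc.2 h1τ.le) ht ht.1
    simp only [hρdef]
    linarith
  set K : Set E := Metric.closedBall x₀ (ρ 1) with hKdef
  have hK : IsCompact K := isCompact_closedBall _ _
  have hw0 : ∀ t ∈ Icc 1 τ, ∀ x, x ∉ K → coneWeight (ρ t) x₀ x = 0 := fun t ht x hx => by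
    refine coneWeight_eq_zero (hρpos t ht).le ?_
    rw [hKdef, Metric.mem_closedBall, dist_eq_norm, not_le] at hx
    exact (hρle t ht).trans hx.le
  have hcu : ContinuousOn (fun z : ℝ × E => u z.1 z.2) (Icc 1 τ ×ˢ univ) :=
    hu.continuousOn.mono (prod_mono sub1 subset_rfl)
  have hcD : ∀ v, ContinuousOn (fun z : ℝ × E => dirDeriv T u v z.1 z.2) (Icc 1 τ ×ˢ univ) :=
    fun v => (continuousOn_dirDeriv hu v).mono (prod_mono sub1 subset_rfl)
  have hcD2 : ∀ v w, ContinuousOn (fun z : ℝ × E => dirDeriv2 u v w z.1 z.2)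
      (Ioo 1 τ ×ˢ univ) :=
    fun v w => (continuousOn_dirDeriv2 hu v w).mono (prod_mono sub2 subset_rfl)
  have hca : ContinuousOn (fun z : ℝ × E => a z.1) (Icc 1 τ ×ˢ univ) :=
    (hac.mono sub1).comp continuousOn_fst fun z hz => hz.1
  have hca' : ContinuousOn (fun z : ℝ × E => a' z.1) (Ioo 1 τ ×ˢ univ) :=
    (hac'.mono sub2).comp continuousOn_fst fun z hz => hz.1
  have hcρ : ContinuousOn (fun z : ℝ × E => ρ z.1) (Icc 1 τ ×ˢ univ) :=
    (continuousOn_const.sub hAc).comp continuousOn_fst fun z hz => hz.1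
  have sub3' : (Ioo 1 τ ×ˢ univ : Set (ℝ × E)) ⊆ Icc 1 τ ×ˢ univ := prod_mono sub3 subset_rfl
  obtain ⟨M₀, hM₀⟩ := (isCompact_Icc.prod hK).exists_bound_of_continuousOn
    (hcu.mono (prod_mono subset_rfl (subset_univ K)))
  -- On the compact cone `u` is bounded and `p > 1`, so the nonlinearity is dominated by the linear
  -- term `M |u|`.
  set M : ℝ := (max M₀ 0) ^ (p - 1) with hMdef
  have hM0 : 0 ≤ M := Real.rpow_nonneg (le_max_right _ _) _
  have hM : ∀ t ∈ Icc 1 τ, ∀ x ∈ K, |u t x| ^ p ≤ M * |u t x| := fun t ht x hx => by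
    have h2 : |u t x| ≤ max M₀ 0 := (hM₀ (t, x) ⟨ht, hx⟩).trans (le_max_left _ _)
    have h3 : |u t x| ^ p = |u t x| ^ (p - 1) * |u t x| := by
      rw [← Real.rpow_add_one' (abs_nonneg _) (by linarith)]
      simp
    rw [h3]
    exact mul_le_mul_of_nonneg_right
      (Real.rpow_le_rpow (abs_nonneg _) h2 (by linarith)) (abs_nonneg _)
  set G : ℝ → E → ℝ := fun t x => ∑ i, dirDeriv T u (0, b i) t x ^ 2 with hGdef
  have hG0 : ∀ t x, 0 ≤ G t x := fun t x => Finset.sum_nonneg fun i _ => sq_nonneg _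
  have hcG : ContinuousOn (fun z : ℝ × E => G z.1 z.2) (Icc 1 τ ×ˢ univ) :=
    continuousOn_finsetSum _ fun i _ => (hcD (0, b i)).pow 2
  -- The term `u ^ 2` lets the energy control the nonlinearity and lets a vanishing energy force `u
  -- = 0`.
  set e : ℝ → E → ℝ := fun t x => dirDeriv T u (1, 0) t x ^ 2 + a t ^ 2 * G t x + u t x ^ 2
    with hedef
  have he0 : ∀ t x, 0 ≤ e t x := fun t x => by have := hG0 t x; positivity
  have hce : ContinuousOn (fun z : ℝ × E => e z.1 z.2) (Icc 1 τ ×ˢ univ) :=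
    (((hcD (1, 0)).pow 2).add ((hca.pow 2).mul hcG)).add (hcu.pow 2)
  set χ : ℝ → E → ℝ := fun t x => max (ρ t ^ 2 - ‖x - x₀‖ ^ 2) 0 with hχdef
  have hχ0 : ∀ t x, 0 ≤ χ t x := fun t x => le_max_right _ _
  have hcχ : ContinuousOn (fun z : ℝ × E => χ z.1 z.2) (Icc 1 τ ×ˢ univ) := by
    have h : ContinuousOn (fun z : ℝ × E => ρ z.1 ^ 2 - ‖z.2 - x₀‖ ^ 2) (Icc 1 τ ×ˢ univ) :=
      (hcρ.pow 2).sub (by fun_prop)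
    exact h.sup continuousOn_const
  have hwχ : ∀ t x, coneWeight (ρ t) x₀ x = χ t x ^ 2 := fun t x => rfl
  set F : ℝ → E → ℝ := fun t x => χ t x ^ 2 * e t x with hFdef
  set X : ℝ → E → ℝ := fun t x => ∑ i, 2 * dirDeriv T u (0, b i) t x *
    dirDeriv2 u (0, b i) (1, 0) t x with hXdef
  have hcX : ContinuousOn (fun z : ℝ × E => X z.1 z.2) (Ioo 1 τ ×ˢ univ) :=
    continuousOn_finsetSum _ fun i _ =>
      (continuousOn_const.mul ((hcD (0, b i)).mono sub3')).mul (hcD2 _ _)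
  set F' : ℝ → E → ℝ := fun t x => 2 * χ t x * (2 * ρ t * -a t) * e t x + χ t x ^ 2 *
    (2 * dirDeriv T u (1, 0) t x * dirDeriv2 u (1, 0) (1, 0) t x +
      (2 * a t * a' t * G t x + a t ^ 2 * X t x) +
      2 * u t x * dirDeriv T u (1, 0) t x) with hF'def
  have hcF : ContinuousOn (fun z : ℝ × E => F z.1 z.2) (Icc 1 τ ×ˢ univ) := (hcχ.pow 2).mul hce
  have hcF' : ContinuousOn (fun z : ℝ × E => F' z.1 z.2) (Ioo 1 τ ×ˢ univ) := by
    have h1 := hcχ.mono sub3'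
    have h2 := hcρ.mono sub3'
    have h3 := hca.mono sub3'
    have h4 := hce.mono sub3'
    have h5 := (hcD (1, 0)).mono sub3'
    have h6 := hcG.mono sub3'
    have h7 := hcu.mono sub3'
    have h8 := hcD2 (1, 0) (1, 0)
    exact (((continuousOn_const.mul h1).mul ((continuousOn_const.mul h2).mul h3.neg)).mul h4).add
      ((h1.pow 2).mul (((((continuousOn_const.mul h5).mul h8)).add
        ((((continuousOn_const.mul h3).mul hca').mul h6).add ((h3.pow 2).mul hcX))).add
        ((continuousOn_const.mul h7).mul h5)))
  have hF0 : ∀ t ∈ Icc 1 τ, ∀ x, x ∉ K → F t x = 0 := fun t ht x hx => by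
    have := hw0 t ht x hx
    simp only [hFdef, ← hwχ, this, zero_mul]
  have hFd : ∀ t ∈ Ioo 1 τ, ∀ x, HasDerivAt (fun s => F s x) (F' t x) t := by
    intro t ht x
    have htT := sub2 ht
    have d1 : HasDerivAt (fun s => χ s x ^ 2) (2 * χ t x * (2 * ρ t * -a t)) t :=
      hasDerivAt_coneWeight_radius ((hA t (Ioo_subset_Ico_self htT)).const_sub _) x₀ x
    have d2 : HasDerivAt (fun s => G s x) (X t x) t := by
      refine (HasDerivAt.fun_sum fun i _ =>
        (hasDerivAt_dirDeriv2_time hu (0, b i) htT x).pow 2).congr_deriv ?_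
      simp [hXdef]
    have d3 : HasDerivAt (fun s => e s x) (2 * dirDeriv T u (1, 0) t x *
        dirDeriv2 u (1, 0) (1, 0) t x + (2 * a t * a' t * G t x + a t ^ 2 * X t x) +
        2 * u t x * dirDeriv T u (1, 0) t x) t := by
      refine ((((hasDerivAt_dirDeriv2_time hu (1, 0) htT x).pow 2).add
        (((had t htT).pow 2).mul d2)).add ((hasDerivAt_dirDeriv_time hu htT x).pow 2)).congr_deriv ?_
      simp
    exact d1.mul d3
  have hFi : ∀ t ∈ Icc 1 τ, Integrable (F t) := fun t ht =>
    (hcF.slice ht).integrable_of_hasCompactSupport (HasCompactSupport.intro hK (hF0 t ht))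
  have hle : ∀ t ∈ Ioo 1 τ, ∫ x, F' t x ≤ (M + 1) * ∫ x, F t x := by
    intro t ht
    have htT := sub2 ht
    have htI := sub3 ht
    have ha0 := ha t (Ioo_subset_Ico_self htT)
    set J : ι → E → ℝ := fun i x => -(4 * χ t x * inner ℝ (x - x₀) (b i) *
        (dirDeriv T u (1, 0) t x * dirDeriv T u (0, b i) t x)) +
      χ t x ^ 2 * (dirDeriv2 u (1, 0) (0, b i) t x * dirDeriv T u (0, b i) t x +
        dirDeriv T u (1, 0) t x * dirDeriv2 u (0, b i) (0, b i) t x) with hJdef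
    have hJ := fun i => integral_coneWeight_flux_eq_zero hu htT (hρpos t htI).le x₀ (b i)
    have hJi : ∀ i, Integrable (J i) := fun i => by
      refine (hJ i).1.integrable_of_hasCompactSupport (HasCompactSupport.intro hK fun x hx => ?_)
      have h2 : χ t x ^ 2 = 0 := hw0 t htI x hx
      have h3 : χ t x = 0 := by simpa using h2
      change J i x = 0
      simp [hJdef, h3]
    have hF'i : Integrable (F' t) := by
      refine (hcF'.slice ht).integrable_of_hasCompactSupport
        (HasCompactSupport.intro hK fun x hx => ?_)
      have h2 : χ t x ^ 2 = 0 := hw0 t htI x hx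
      have h3 : χ t x = 0 := by simpa using h2
      simp [hF'def, h3]
    have hSi : Integrable (fun x => 2 * a t ^ 2 * ∑ i, J i x) :=
      (integrable_finsetSum _ fun i _ => hJi i).const_mul _
    have hS : ∫ x, 2 * a t ^ 2 * ∑ i, J i x = 0 := by
      rw [integral_const_mul, integral_finsetSum _ fun i _ => hJi i]
      rw [show ∑ i, ∫ x, J i x = 0 from Finset.sum_eq_zero fun i _ => (hJ i).2, mul_zero]
    -- Subtracting a divergence with zero integral does the work of integration by parts, after
    -- which the estimate holds pointwise.
    have hkey : ∫ x, (F' t x - 2 * a t ^ 2 * ∑ i, J i x) ≤ ∫ x, (M + 1) * F t x := by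
      refine integral_mono (hF'i.sub hSi) ((hFi t htI).const_mul _) fun x => ?_
      by_cases hxK : x ∈ K
      swap
      · have h2 : χ t x ^ 2 = 0 := hw0 t htI x hxK
        have h3 : χ t x = 0 := by simpa using h2
        simp [hF'def, hJdef, hFdef, h3]
      set S : ℝ := ∑ i, inner ℝ (x - x₀) (b i) * dirDeriv T u (0, b i) t x with hSdef
      have hflux : 2 * χ t x * (2 * ρ t * -a t) * e t x +
          2 * a t ^ 2 * (4 * χ t x * dirDeriv T u (1, 0) t x * S) ≤ 0 := by
        refine flux_le_of_sq_le (hχ0 t x) (hρpos t htI).le ha0 (hG0 t x) fun hpos => ?_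
        have h2 : ‖x - x₀‖ ^ 2 ≤ ρ t ^ 2 := by
          by_contra! hcon
          rw [hχdef] at hpos
          simp only [max_eq_right (by linarith : ρ t ^ 2 - ‖x - x₀‖ ^ 2 ≤ 0), lt_irrefl] at hpos
        calc S ^ 2 ≤ (∑ i, (inner ℝ (x - x₀) (b i) : ℝ) ^ 2) * G t x :=
              Finset.sum_mul_sq_le_sq_mul_sq _ _ _
          _ = ‖x - x₀‖ ^ 2 * G t x := by
              congr 1
              simpa using b.sum_sq_inner_left (x - x₀)
          _ ≤ ρ t ^ 2 * G t x := by gcongr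
      have hsumJ : ∑ i, J i x = -(4 * χ t x * dirDeriv T u (1, 0) t x * S) + χ t x ^ 2 *
          (X t x / 2 + dirDeriv T u (1, 0) t x * ∑ i, dirDeriv2 u (0, b i) (0, b i) t x) := by
        simp only [hJdef, hSdef, hXdef, Finset.sum_add_distrib, Finset.sum_neg_distrib,
          ← Finset.mul_sum, Finset.sum_div]
        congr 2
        · rw [Finset.mul_sum]
          exact Finset.sum_congr rfl fun i _ => by ring
        · congr 1
          refine Finset.sum_congr rfl fun i _ => ?_
          rw [dirDeriv2_comm hu (1, 0) (0, b i) htT x]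
          ring
      have hid : F' t x - 2 * a t ^ 2 * ∑ i, J i x =
          (2 * χ t x * (2 * ρ t * -a t) * e t x +
            2 * a t ^ 2 * (4 * χ t x * dirDeriv T u (1, 0) t x * S)) +
          χ t x ^ 2 * (2 * dirDeriv T u (1, 0) t x * (|u t x| ^ p - d t * dirDeriv T u (1, 0) t x)
            + 2 * a t * a' t * G t x + 2 * u t x * dirDeriv T u (1, 0) t x) := by
        rw [hsumJ, ← heq t htT x, hF'def]
        ring
      -- The terms with `d ≥ 0` and `a' ≤ 0` have the favourable sign and are dropped; the rest is
      -- quadratic in `u_t` and `u`.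
      have hrest : 2 * dirDeriv T u (1, 0) t x * (|u t x| ^ p - d t * dirDeriv T u (1, 0) t x)
            + 2 * a t * a' t * G t x + 2 * u t x * dirDeriv T u (1, 0) t x ≤
          (M + 1) * e t x := by
        set v := dirDeriv T u (1, 0) t x with hv
        have hM' := hM t htI x hxK
        have i1 : v * |u t x| ^ p ≤ |v| * (M * |u t x|) :=
          (le_abs_self _).trans (by
            rw [abs_mul, abs_of_nonneg (Real.rpow_nonneg (abs_nonneg _) p)]; gcongr)
        have i2 : u t x * v ≤ |v| * |u t x| := by
          rw [← abs_mul, mul_comm]; exact le_abs_self _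
        have i3 : 2 * (|v| * |u t x|) ≤ v ^ 2 + u t x ^ 2 := by
          nlinarith [sq_nonneg (|v| - |u t x|), sq_abs v, sq_abs (u t x)]
        have i4 : 0 ≤ d t * v ^ 2 := mul_nonneg (hd t htT) (sq_nonneg v)
        have i5 : a t * a' t * G t x ≤ 0 := by
          have := mul_nonneg (mul_nonneg ha0 (neg_nonneg.2 (ha' t htT))) (hG0 t x)
          linarith
        have i6 : v ^ 2 + u t x ^ 2 ≤ e t x := by
          have : 0 ≤ a t ^ 2 * G t x := mul_nonneg (sq_nonneg _) (hG0 t x)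
          simp only [hedef]
          linarith
        calc _ ≤ (M + 1) * (2 * (|v| * |u t x|)) := by linarith
          _ ≤ (M + 1) * e t x := by gcongr; exact i3.trans i6
      change F' t x - 2 * a t ^ 2 * ∑ i, J i x ≤ (M + 1) * F t x
      rw [hid]
      have := mul_le_mul_of_nonneg_left hrest (sq_nonneg (χ t x))
      simp only [hFdef]
      linarith
    rw [integral_sub hF'i hSi, hS, sub_zero, integral_const_mul] at hkey
    exact hkey
  have hstart : ∫ x, F 1 x = 0 := by
    refine integral_eq_zero_of_ae (Eventually.of_forall fun x => ?_)
    change χ 1 x ^ 2 * e 1 x = 0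
    rcases le_or_gt (ρ 1) ‖x - x₀‖ with hxx | hxx
    · rw [← hwχ, coneWeight_eq_zero (hρpos 1 (left_mem_Icc.2 h1τ.le)).le hxx, zero_mul]
    have hRx : R < ‖x‖ := by
      have := norm_sub_norm_le x₀ x
      rw [norm_sub_rev] at this
      simp only [hρdef, hA1] at hxx
      linarith
    have hgrad : ∀ i, dirDeriv T u (0, b i) 1 x = 0 := fun i => by
      have hev : u 1 =ᶠ[𝓝 x] fun _ => 0 := by
        filter_upwards [(isOpen_lt continuous_const continuous_norm).mem_nhds hRx] with y hy
          using h0 y hy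
      rw [← fderiv_apply_eq_dirDeriv hu ⟨le_rfl, h1τ.trans hτ.2⟩, hev.fderiv_eq]
      simp
    simp [hedef, hGdef, hgrad, h0 x hRx, h1 x hRx]
  have hend0 : 0 ≤ ∫ x, F τ x := integral_nonneg fun x => mul_nonneg (sq_nonneg _) (he0 τ x)
  have hzero : ∫ x, F τ x = 0 :=
    eq_zero_of_deriv_le_mul h1τ.le
      (continuousOn_integral_of_compact_support (f := F) hK hcF fun t x ht hx => hF0 t ht x hx)
      (fun t ht => hasDerivAt_integral_of_compact_support ht hK (hcF.mono sub3') hcF' hFd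
        fun s hs => hF0 s (sub3 hs)) hle hstart hend0
  by_contra hne
  have hτI : τ ∈ Icc 1 τ := right_mem_Icc.2 h1τ.le
  have hpos : 0 < ∫ x, F τ x := by
    refine (hcF.slice hτI).integral_pos_of_hasCompactSupport_nonneg_nonzero
      (HasCompactSupport.intro hK (hF0 τ hτI)) (fun x => mul_nonneg (sq_nonneg _) (he0 τ x))
      (x := x₀) ?_
    have h2 : 0 < χ τ x₀ ^ 2 := coneWeight_self (hρpos τ hτI) x₀
    have h3 : 0 < e τ x₀ := by
      have := mul_nonneg (sq_nonneg (a τ)) (hG0 τ x₀)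
      have : 0 < u τ x₀ ^ 2 := by positivity
      simp only [hedef]
      nlinarith [sq_nonneg (dirDeriv T u (1, 0) τ x₀)]
    exact (mul_pos h2 h3).ne'
  exact hpos.ne' hzero

/-! ### Classical solutions in terms of directional derivatives, and their supports. -/

theorem IsClassicalSolution.mono {n : ℕ} {k d : ℝ → ℝ} {p : ℝ}
    {f g : EuclideanSpace ℝ (Fin n) → ℝ} {T T' : EReal}
    {u : ℝ → EuclideanSpace ℝ (Fin n) → ℝ} (h : IsClassicalSolution k d p f g T u)
    (h1 : 1 < T') (hle : T' ≤ T) : IsClassicalSolution k d p f g T' u where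
  one_lt := h1
  contDiffOn := h.contDiffOn.mono
    (prod_mono (fun _ ht => ⟨ht.1, ht.2.trans_le hle⟩) subset_rfl)
  equation := fun t ht htT x => h.equation t ht (htT.trans_le hle) x
  initial_value := h.initial_value
  initial_velocity := h.initial_velocity

theorem IsClassicalSolution.contDiffOn_strip {n : ℕ} {k d : ℝ → ℝ} {p T : ℝ}
    {f g : EuclideanSpace ℝ (Fin n) → ℝ} {u : ℝ → EuclideanSpace ℝ (Fin n) → ℝ}
    (h : IsClassicalSolution k d p f g T u) :
    ContDiffOn ℝ 2 (fun z : ℝ × EuclideanSpace ℝ (Fin n) => u z.1 z.2) (Ico 1 T ×ˢ univ) := by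
  have heq : Ico 1 T = {t : ℝ | 1 ≤ t ∧ (t : EReal) < T} := by
    ext t
    simp
  rw [heq]
  exact h.contDiffOn

theorem IsClassicalSolution.one_lt_real {n : ℕ} {k d : ℝ → ℝ} {p T : ℝ}
    {f g : EuclideanSpace ℝ (Fin n) → ℝ} {u : ℝ → EuclideanSpace ℝ (Fin n) → ℝ}
    (h : IsClassicalSolution k d p f g T u) : 1 < T := by
  exact_mod_cast h.one_lt

theorem IsClassicalSolution.dirDeriv_one {n : ℕ} {k d : ℝ → ℝ} {p T : ℝ}
    {f g : EuclideanSpace ℝ (Fin n) → ℝ} {u : ℝ → EuclideanSpace ℝ (Fin n) → ℝ}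
    (h : IsClassicalSolution k d p f g T u) (x : EuclideanSpace ℝ (Fin n)) :
    dirDeriv T u (1, 0) 1 x = g x := by
  have h1 : (1 : ℝ) ∈ Ico 1 T := ⟨le_rfl, h.one_lt_real⟩
  exact (uniqueDiffOn_Ico 1 T 1 h1).eq_deriv _
    (hasDerivWithinAt_dirDeriv_time h.contDiffOn_strip h1 x)
    ((h.initial_velocity x).mono Ico_subset_Ici_self)

theorem IsClassicalSolution.equation_dirDeriv {n : ℕ} {k d : ℝ → ℝ} {p T : ℝ}
    {f g : EuclideanSpace ℝ (Fin n) → ℝ} {u : ℝ → EuclideanSpace ℝ (Fin n) → ℝ}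
    (h : IsClassicalSolution k d p f g T u) {t : ℝ} (ht : t ∈ Ioo 1 T)
    (x : EuclideanSpace ℝ (Fin n)) :
    dirDeriv2 u (1, 0) (1, 0) t x
      - k t * ∑ i, dirDeriv2 u (0, EuclideanSpace.basisFun (Fin n) ℝ i)
        (0, EuclideanSpace.basisFun (Fin n) ℝ i) t x
      + d t * dirDeriv T u (1, 0) t x = |u t x| ^ p := by
  have hu := h.contDiffOn_strip
  rw [← h.equation t ht.1 (by exact_mod_cast ht.2) x, iteratedDeriv_two_eq_dirDeriv2 hu ht,
    laplacian_eq_sum_dirDeriv2 (EuclideanSpace.basisFun (Fin n) ℝ) hu ht,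
    (hasDerivAt_dirDeriv_time hu ht x).deriv]

theorem eq_zero_of_tsupport_subset_closedBall {E : Type*} [NormedAddCommGroup E] {f : E → ℝ}
    {R : ℝ} (hf : tsupport f ⊆ Metric.closedBall 0 R) {x : E} (hx : R < ‖x‖) : f x = 0 := by
  refine image_eq_zero_of_notMem_tsupport fun hmem => ?_
  have := hf hmem
  rw [mem_closedBall_zero_iff] at this
  linarith

/-- Finite speed of propagation for the power-law problem. -/
theorem IsPowerSolution.eq_zero_of_add_lt_norm {n : ℕ} {α μ p ε R T : ℝ}
    {u₀ u₁ : EuclideanSpace ℝ (Fin n) → ℝ} {u : ℝ → EuclideanSpace ℝ (Fin n) → ℝ}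
    (hp : 1 < p) (hα : 0 ≤ α) (hμ : 0 ≤ μ)
    (hu₀_supp : tsupport u₀ ⊆ Metric.closedBall 0 R)
    (hu₁_supp : tsupport u₁ ⊆ Metric.closedBall 0 R)
    (h : IsPowerSolution α μ p ε u₀ u₁ (T : EReal) u)
    {A : ℝ → ℝ} (hA : ∀ t, 1 ≤ t → HasDerivAt A (t ^ (-α)) t) (hA1 : A 1 = 0)
    {t : ℝ} (ht : t ∈ Ico 1 T) {x : EuclideanSpace ℝ (Fin n)} (hx : R + A t < ‖x‖) :
    u t x = 0 := by
  have hpos : ∀ {s : ℝ}, 1 ≤ s → 0 < s := fun hs => by linarith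
  have hderiv : ∀ s : ℝ, 1 ≤ s → HasDerivAt (fun s : ℝ => s ^ (-α)) (-α * s ^ (-α - 1)) s :=
    fun s hs => Real.hasDerivAt_rpow_const (Or.inl (hpos hs).ne')
  refine _root_.eq_zero_of_add_lt_norm (EuclideanSpace.basisFun (Fin n) ℝ)
    (a := fun s => s ^ (-α)) (a' := fun s => -α * s ^ (-α - 1)) (d := fun s => μ / s) (R := R)
    (A := A) hp h.contDiffOn_strip (fun s hs => Real.rpow_nonneg (hpos hs.1).le _)
    (fun s hs => (hderiv s hs.1).continuousAt.continuousWithinAt)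
    (fun s hs => hderiv s hs.1.le) ?_ ?_ (fun s hs => hA s hs.1) hA1
    (fun s hs => div_nonneg hμ (hpos hs.1.le).le) ?_ ?_ ?_ ht hx
  · exact continuousOn_const.mul fun s hs =>
      (Real.continuousAt_rpow_const _ _ (Or.inl (hpos hs.1.le).ne')).continuousWithinAt
  · intro s hs
    have := mul_nonneg hα (Real.rpow_nonneg (hpos hs.1.le).le (-α - 1))
    linarith
  · intro s hs x
    rw [← h.equation_dirDeriv hs x]
    have : (s ^ (-α)) ^ 2 = 1 / s ^ (2 * α) := by
      rw [← Real.rpow_natCast, ← Real.rpow_mul (hpos hs.1.le).le, one_div,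
        ← Real.rpow_neg (hpos hs.1.le).le]
      congr 1
      push_cast
      ring
    simp only [this]
  · intro x hx
    rw [h.initial_value, eq_zero_of_tsupport_subset_closedBall hu₀_supp hx, mul_zero]
  · intro x hx
    rw [h.dirDeriv_one, eq_zero_of_tsupport_subset_closedBall hu₁_supp hx, mul_zero]

/-! ### The differential inequality for the spatial integral. -/

/-- The spatial mean of a solution satisfies a second order differential inequality. -/
theorem IsPowerSolution.exists_mean {n : ℕ} {α μ p ε R T : ℝ}
    {u₀ u₁ : EuclideanSpace ℝ (Fin n) → ℝ} {u : ℝ → EuclideanSpace ℝ (Fin n) → ℝ}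
    (hp : 1 < p) (hR : 0 < R) (hε : 0 ≤ ε) (hα : 0 ≤ α) (hμ : 0 ≤ μ)
    (hu₀_nonneg : ∀ x, 0 ≤ u₀ x) (hu₁_nonneg : ∀ x, 0 ≤ u₁ x)
    (hu₀_supp : tsupport u₀ ⊆ Metric.closedBall 0 R)
    (hu₁_supp : tsupport u₁ ⊆ Metric.closedBall 0 R)
    (h : IsPowerSolution α μ p ε u₀ u₁ (T : EReal) u)
    {A : ℝ → ℝ} (hA : ∀ t, 1 ≤ t → HasDerivAt A (t ^ (-α)) t) (hA1 : A 1 = 0) :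
    ∃ U U1 U2 : ℝ → ℝ, ∀ t ∈ Ioo 1 T, HasDerivAt U (U1 t) t ∧ HasDerivAt U1 (U2 t) t ∧
      0 ≤ U1 t ∧ ε * ∫ x, u₀ x ≤ U t ∧
      (volume.real (Metric.closedBall (0 : EuclideanSpace ℝ (Fin n)) (R + A t))) ^ (1 - p)
        * U t ^ p ≤ U2 t + μ / t * U1 t := by
  set b := EuclideanSpace.basisFun (Fin n) ℝ with hb
  have hu := h.contDiffOn_strip
  have hT := h.one_lt_real
  have hAmono : MonotoneOn A (Ici 1) :=
    monotoneOn_of_hasDerivWithinAt_nonneg (convex_Ici 1)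
      (fun t ht => (hA t ht).continuousAt.continuousWithinAt)
      (fun t ht => (hA t (interior_subset ht)).hasDerivWithinAt)
      fun t ht => Real.rpow_nonneg (zero_le_one.trans (interior_subset ht : (1 : ℝ) ≤ t)) _
  have hA0 : ∀ t, 1 ≤ t → 0 ≤ A t := fun t ht => by
    rw [← hA1]
    exact hAmono self_mem_Ici ht ht
  set K : ℝ → Set (EuclideanSpace ℝ (Fin n)) := fun τ => Metric.closedBall 0 (R + A τ) with hKdef
  have hK : ∀ τ, IsCompact (K τ) := fun τ => isCompact_closedBall _ _
  have hKnot : ∀ {τ x}, x ∉ K τ → R + A τ < ‖x‖ := fun hx => by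
    simpa [hKdef] using hx
  have hz : ∀ τ ∈ Ico 1 T, ∀ s ∈ Icc 1 τ, ∀ x, x ∉ K τ → u s x = 0 := by
    intro τ hτ s hs x hx
    refine h.eq_zero_of_add_lt_norm hp hα hμ hu₀_supp hu₁_supp hA hA1
      ⟨hs.1, hs.2.trans_lt hτ.2⟩ (lt_of_le_of_lt ?_ (hKnot hx))
    have := hAmono (mem_Ici.2 hs.1) (mem_Ici.2 hτ.1) hs.2
    linarith
  have hz1 : ∀ τ ∈ Ico 1 T, ∀ s ∈ Ico 1 τ, ∀ x, x ∉ K τ → dirDeriv T u (1, 0) s x = 0 := by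
    intro τ hτ s hs x hx
    rcases hs.1.eq_or_lt with rfl | h1s
    · rw [h.dirDeriv_one, eq_zero_of_tsupport_subset_closedBall hu₁_supp, mul_zero]
      have := hA0 τ hτ.1
      linarith [hKnot hx]
    · have hev : (fun r => u r x) =ᶠ[𝓝 s] fun _ => 0 := by
        filter_upwards [Ioo_mem_nhds h1s hs.2] with r hr using hz τ hτ r (Ioo_subset_Icc_self hr) x hx
      exact (hasDerivAt_dirDeriv_time hu ⟨h1s, hs.2.trans hτ.2⟩ x).unique
        ((hasDerivAt_const s (0 : ℝ)).congr_of_eventuallyEq hev)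
  have hsubIcc : ∀ τ ∈ Ico 1 T, Icc 1 τ ⊆ Ico 1 T :=
    fun τ hτ s hs => ⟨hs.1, hs.2.trans_lt hτ.2⟩
  have hsubIoo : ∀ τ ∈ Ico 1 T, Ioo 1 τ ⊆ Ioo 1 T :=
    fun τ hτ s hs => ⟨hs.1, hs.2.trans hτ.2⟩
  set U : ℝ → ℝ := fun t => ∫ x, u t x with hUdef
  set U1 : ℝ → ℝ := fun t => ∫ x, dirDeriv T u (1, 0) t x with hU1def
  set U2 : ℝ → ℝ := fun t => ∫ x, dirDeriv2 u (1, 0) (1, 0) t x with hU2def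
  have hUd : ∀ t ∈ Ioo 1 T, HasDerivAt U (U1 t) t := by
    intro t ht
    -- A time `τ` beyond `t` provides one compact set `K τ` containing the supports at all times
    -- near `t`.
    obtain ⟨τ, h1, h2⟩ := exists_between ht.2
    have hτ : τ ∈ Ico 1 T := ⟨(ht.1.trans h1).le, h2⟩
    have hs : Ioo 1 τ ⊆ Ico 1 T := (hsubIoo τ hτ).trans Ioo_subset_Ico_self
    exact hasDerivAt_integral_of_compact_support ⟨ht.1, h1⟩ (hK τ)
      (hu.continuousOn.mono (prod_mono hs subset_rfl))
      ((continuousOn_dirDeriv hu (1, 0)).mono (prod_mono hs subset_rfl))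
      (fun s hs x => hasDerivAt_dirDeriv_time hu (hsubIoo τ hτ hs) x)
      fun s hs x hx => hz τ hτ s (Ioo_subset_Icc_self hs) x hx
  have hU1d : ∀ t ∈ Ioo 1 T, HasDerivAt U1 (U2 t) t := by
    intro t ht
    obtain ⟨τ, h1, h2⟩ := exists_between ht.2
    have hτ : τ ∈ Ico 1 T := ⟨(ht.1.trans h1).le, h2⟩
    have hs : Ioo 1 τ ⊆ Ico 1 T := (hsubIoo τ hτ).trans Ioo_subset_Ico_self
    exact hasDerivAt_integral_of_compact_support ⟨ht.1, h1⟩ (hK τ)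
      ((continuousOn_dirDeriv hu (1, 0)).mono (prod_mono hs subset_rfl))
      ((continuousOn_dirDeriv2 hu (1, 0) (1, 0)).mono (prod_mono (hsubIoo τ hτ) subset_rfl))
      (fun s hs x => hasDerivAt_dirDeriv2_time hu (1, 0) (hsubIoo τ hτ hs) x)
      fun s hs x hx => hz1 τ hτ s (Ioo_subset_Ico_self hs) x hx
  -- The derivatives of `U` are available only for `t > 1`; continuity up to `t = 1` lets the
  -- monotonicity arguments start from the data.
  have hUc : ∀ t ∈ Ioo 1 T, ContinuousOn U (Icc 1 t) := fun t ht =>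
    continuousOn_integral_of_compact_support (f := u) (hK t)
      (hu.continuousOn.mono (prod_mono (hsubIcc t ⟨ht.1.le, ht.2⟩) subset_rfl))
      fun s x hs hx => hz t ⟨ht.1.le, ht.2⟩ s hs x hx
  have hU1c : ∀ t ∈ Ioo 1 T, ContinuousOn U1 (Icc 1 t) := by
    intro t ht
    obtain ⟨τ, h1, h2⟩ := exists_between ht.2
    have hτ : τ ∈ Ico 1 T := ⟨(ht.1.trans h1).le, h2⟩
    exact continuousOn_integral_of_compact_support (f := dirDeriv T u (1, 0)) (hK τ)
      ((continuousOn_dirDeriv hu (1, 0)).mono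
        (prod_mono (hsubIcc t ⟨ht.1.le, ht.2⟩) subset_rfl))
      fun s x hs hx => hz1 τ hτ s ⟨hs.1, hs.2.trans_lt h1⟩ x hx
  -- The equation is integrated over space; each pure second derivative has zero integral by compact
  -- support.
  have hODE : ∀ t ∈ Ioo 1 T, U2 t + μ / t * U1 t = ∫ x, |u t x| ^ p := by
    intro t ht
    obtain ⟨τ, h1, h2⟩ := exists_between ht.2
    have hτ : τ ∈ Ico 1 T := ⟨(ht.1.trans h1).le, h2⟩
    have ht' : t ∈ Ico 1 T := Ioo_subset_Ico_self ht
    have hzt : ∀ x, x ∉ K τ → u t x = 0 := hz τ hτ t ⟨ht.1.le, h1.le⟩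
    have hgrad : ∀ i x, x ∉ K τ → dirDeriv T u (0, b i) t x = 0 := by
      intro i x hx
      have hev : u t =ᶠ[𝓝 x] fun _ => 0 := by
        filter_upwards [(hK τ).isClosed.isOpen_compl.mem_nhds hx] with y hy using hzt y hy
      rw [← fderiv_apply_eq_dirDeriv hu ht', hev.fderiv_eq]
      simp
    have hhess : ∀ i x, x ∉ K τ → dirDeriv2 u (0, b i) (0, b i) t x = 0 := by
      intro i x hx
      have hev : (fun y => dirDeriv T u (0, b i) t y) =ᶠ[𝓝 x] fun _ => 0 := by
        filter_upwards [(hK τ).isClosed.isOpen_compl.mem_nhds hx] with y hy using hgrad i y hy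
      have := (hasFDerivAt_dirDeriv2_space hu (0, b i) ht x).fderiv
      rw [hev.fderiv_eq] at this
      have := DFunLike.congr_fun this (b i)
      simpa [dirDeriv2] using this.symm
    have hlap : ∀ i, ∫ x, dirDeriv2 u (0, b i) (0, b i) t x = 0 := fun i =>
      integral_hasFDerivAt_apply_eq_zero
        (fun x => hasFDerivAt_dirDeriv2_space hu (0, b i) ht x) (v := b i)
        ((continuousOn_dirDeriv2 hu (0, b i) (0, b i)).slice ht) (hK τ) (hgrad i)
    have hi1 : Integrable (dirDeriv T u (1, 0) t) :=
      ((continuousOn_dirDeriv hu (1, 0)).slice ht').integrable_of_hasCompactSupport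
        (HasCompactSupport.intro (hK τ) (hz1 τ hτ t ⟨ht.1.le, h1⟩))
    have hi2 : ∀ i, Integrable (dirDeriv2 u (0, b i) (0, b i) t) := fun i =>
      ((continuousOn_dirDeriv2 hu _ _).slice ht).integrable_of_hasCompactSupport
        (HasCompactSupport.intro (hK τ) (hhess i))
    have hi3 : Integrable (fun x => |u t x| ^ p) := by
      refine ((ContinuousOn.slice hu.continuousOn ht').abs.rpow_const
        fun x => Or.inr (by linarith)).integrable_of_hasCompactSupport
        (HasCompactSupport.intro (hK τ) fun x hx => ?_)
      rw [hzt x hx, abs_zero, Real.zero_rpow (by linarith)]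
    have hutt : dirDeriv2 u (1, 0) (1, 0) t = fun x => |u t x| ^ p
        + 1 / t ^ (2 * α) * ∑ i, dirDeriv2 u (0, b i) (0, b i) t x
        - μ / t * dirDeriv T u (1, 0) t x := by
      funext x
      rw [← h.equation_dirDeriv ht x]
      ring
    have hi4 : Integrable (fun x => 1 / t ^ (2 * α) * ∑ i, dirDeriv2 u (0, b i) (0, b i) t x) :=
      (integrable_finsetSum _ fun i _ => hi2 i).const_mul _
    have hU2 : U2 t = ∫ x, (|u t x| ^ p + 1 / t ^ (2 * α) *
        ∑ i, dirDeriv2 u (0, b i) (0, b i) t x - μ / t * dirDeriv T u (1, 0) t x) := by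
      simp only [hU2def, hutt]
    have hi5 : Integrable (fun x => |u t x| ^ p + 1 / t ^ (2 * α) *
        ∑ i, dirDeriv2 u (0, b i) (0, b i) t x) := hi3.add hi4
    rw [hU2, integral_sub hi5 (hi1.const_mul _), integral_add hi3 hi4, integral_const_mul,
      integral_const_mul, integral_finsetSum _ fun i _ => hi2 i]
    simp only [hlap, Finset.sum_const_zero, mul_zero, add_zero]
    ring
  -- `t ^ μ * U1` is nondecreasing because the source is nonnegative, and it starts from `ε ∫ u₁ ≥
  -- 0`.
  have hU1nonneg : ∀ t ∈ Ioo 1 T, 0 ≤ U1 t := by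
    intro t ht
    have ht0 : (0 : ℝ) < t := by linarith [ht.1]
    have hd : ∀ s ∈ interior (Icc 1 t), HasDerivAt (fun s => s ^ μ * U1 s)
        (μ * s ^ (μ - 1) * U1 s + s ^ μ * U2 s) s := fun s hs => by
      rw [interior_Icc] at hs
      exact (Real.hasDerivAt_rpow_const (Or.inl (by linarith [hs.1]))).mul
        (hU1d s ⟨hs.1, hs.2.trans ht.2⟩)
    have hmono : MonotoneOn (fun s => s ^ μ * U1 s) (Icc 1 t) := by
      refine monotoneOn_of_hasDerivWithinAt_nonneg (convex_Icc 1 t) ?_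
        (fun s hs => (hd s hs).hasDerivWithinAt) fun s hs => ?_
      · exact (continuousOn_id.rpow_const fun s _ => Or.inr hμ).mul (hU1c t ht)
      · rw [interior_Icc] at hs
        have hs0 : (0 : ℝ) < s := by linarith [hs.1]
        have h1 : 0 ≤ U2 s + μ / s * U1 s := by
          rw [hODE s ⟨hs.1, hs.2.trans ht.2⟩]
          exact integral_nonneg fun x => Real.rpow_nonneg (abs_nonneg _) _
        rw [Real.rpow_sub_one hs0.ne']
        have h2 := mul_nonneg (Real.rpow_nonneg hs0.le μ) h1
        have h3 : s ^ μ * (U2 s + μ / s * U1 s) = μ * (s ^ μ / s) * U1 s + s ^ μ * U2 s := by ring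
        linarith
    have h1 := hmono (left_mem_Icc.2 ht.1.le) (right_mem_Icc.2 ht.1.le) ht.1.le
    have h2 : 0 ≤ U1 1 := integral_nonneg fun x => by
      rw [h.dirDeriv_one]
      exact mul_nonneg hε (hu₁_nonneg x)
    simp only [Real.one_rpow, one_mul] at h1
    exact nonneg_of_mul_nonneg_right (h2.trans h1) (Real.rpow_pos_of_pos ht0 μ)
  have hUlow : ∀ t ∈ Ioo 1 T, ε * ∫ x, u₀ x ≤ U t := by
    intro t ht
    have hint : ∀ s ∈ interior (Icc 1 t), s ∈ Ioo 1 T := fun s hs => by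
      rw [interior_Icc] at hs
      exact ⟨hs.1, hs.2.trans ht.2⟩
    have hmono : MonotoneOn U (Icc 1 t) :=
      monotoneOn_of_hasDerivWithinAt_nonneg (convex_Icc 1 t) (hUc t ht)
        (fun s hs => (hUd s (hint s hs)).hasDerivWithinAt) fun s hs => hU1nonneg s (hint s hs)
    refine le_of_eq_of_le ?_ (hmono (left_mem_Icc.2 ht.1.le) (right_mem_Icc.2 ht.1.le) ht.1.le)
    simp only [hUdef, h.initial_value, integral_const_mul]
  refine ⟨U, U1, U2, fun t ht => ⟨hUd t ht, hU1d t ht, hU1nonneg t ht, hUlow t ht, ?_⟩⟩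
  have ht' : t ∈ Ico 1 T := Ioo_subset_Ico_self ht
  have hVpos : 0 < volume.real (K t) := by
    have hr : 0 < R + A t := by linarith [hA0 t ht.1.le]
    exact ENNReal.toReal_pos (Metric.measure_closedBall_pos volume _ hr).ne' (hK t).measure_ne_top
  have hU0 : 0 ≤ U t := (mul_nonneg hε (integral_nonneg hu₀_nonneg)).trans (hUlow t ht)
  have hJ := mul_integral_div_rpow_le hp (ContinuousOn.slice hu.continuousOn ht') (hK t) hVpos
    (hz t ht' t (right_mem_Icc.2 ht.1.le)) hU0
  rw [hODE t ht]
  refine le_of_eq_of_le ?_ hJ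
  change volume.real (K t) ^ (1 - p) * U t ^ p = volume.real (K t) * (U t / volume.real (K t)) ^ p
  rw [Real.div_rpow hU0 hVpos.le, Real.rpow_sub hVpos, Real.rpow_one]
  ring

/-- Along a power-law solution on `[1, T)`, for `1 < a` with `2a < T`, the volume reached by the
wave at time `2a` controls the size of the initial data. -/
theorem IsPowerSolution.mean_bound {n : ℕ} {α μ p ε R T : ℝ}
    {u₀ u₁ : EuclideanSpace ℝ (Fin n) → ℝ} {u : ℝ → EuclideanSpace ℝ (Fin n) → ℝ}
    (hp : 1 < p) (hR : 0 < R) (hε : 0 < ε) (hα : 0 ≤ α) (hμ : 0 ≤ μ)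
    (hu₀_nonneg : ∀ x, 0 ≤ u₀ x) (hu₁_nonneg : ∀ x, 0 ≤ u₁ x) (hI : 0 < ∫ x, u₀ x)
    (hu₀_supp : tsupport u₀ ⊆ Metric.closedBall 0 R)
    (hu₁_supp : tsupport u₁ ⊆ Metric.closedBall 0 R)
    (h : IsPowerSolution α μ p ε u₀ u₁ (T : EReal) u)
    {A : ℝ → ℝ} (hA : ∀ t, 1 ≤ t → HasDerivAt A (t ^ (-α)) t) (hA1 : A 1 = 0)
    {a B : ℝ} (ha : 1 < a) (haT : 2 * a < T) (hB : ∀ t ∈ Icc 1 (2 * a), A t ≤ B) :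
    volume.real (Metric.closedBall (0 : EuclideanSpace ℝ (Fin n)) (R + B)) ^ (1 - p)
      * (ε * ∫ x, u₀ x) ^ (p - 1) * a ^ 2
      ≤ 2 ^ (μ + 1) / (1 - 2 ^ (-((p - 1) / 2))) ^ 2 := by
  obtain ⟨U, U1, U2, hU⟩ := h.exists_mean hp hR hε.le hα hμ hu₀_nonneg hu₁_nonneg hu₀_supp
    hu₁_supp hA hA1
  have hB0 : 0 ≤ B := hA1 ▸ hB 1 ⟨le_rfl, by linarith⟩
  have hVpos : ∀ r : ℝ, 0 < r →
      0 < volume.real (Metric.closedBall (0 : EuclideanSpace ℝ (Fin n)) r) := fun r hr =>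
    ENNReal.toReal_pos (Metric.measure_closedBall_pos volume _ hr).ne'
      (isCompact_closedBall _ _).measure_ne_top
  have hsub : ∀ t ∈ Icc a (2 * a), t ∈ Ioo 1 T :=
    fun t ht => ⟨ha.trans_le ht.1, ht.2.trans_lt haT⟩
  have hAmono : MonotoneOn A (Ici 1) :=
    monotoneOn_of_hasDerivWithinAt_nonneg (convex_Ici 1)
      (fun t ht => (hA t ht).continuousAt.continuousWithinAt)
      (fun t ht => (hA t (interior_subset ht)).hasDerivWithinAt)
      fun t ht => Real.rpow_nonneg (zero_le_one.trans (interior_subset ht : (1 : ℝ) ≤ t)) _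
  have hδ : 0 < ε * ∫ x, u₀ x := mul_pos hε hI
  refine mul_rpow_mul_sq_le_of_deriv2_add_div_mul_deriv_ge hμ hp (by linarith)
    (Real.rpow_pos_of_pos (hVpos _ (by linarith)) _) hδ
    (fun t ht => (hU t (hsub t ht)).1) (fun t ht => (hU t (hsub t ht)).2.1) (fun t ht => ?_)
    (fun t ht => (hU t (hsub t ht)).2.2.1)
    (hU a (hsub a ⟨le_rfl, by linarith⟩)).2.2.2.1
  obtain ⟨-, -, -, hlow, hineq⟩ := hU t (hsub t ht)
  refine le_trans ?_ hineq
  have ht1 : 1 ≤ t := (hsub t ht).1.le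
  have hAt : 0 ≤ A t := hA1 ▸ hAmono self_mem_Ici ht1 ht1
  -- The exponent `1 - p` is negative, so the larger ball of radius `R + B` gives a lower
  -- coefficient, constant on `[a, 2a]`.
  refine mul_le_mul_of_nonneg_right (Real.rpow_le_rpow_of_nonpos (hVpos _ (by linarith)) ?_
    (by linarith)) (Real.rpow_nonneg (hδ.le.trans hlow) p)
  refine measureReal_mono (Metric.closedBall_subset_closedBall ?_)
    (isCompact_closedBall _ _).measure_ne_top
  linarith [hB t ⟨ht1, ht.2⟩]

/-! ### From the mean to the lifespan. -/

theorem hasDerivAt_log_rpow_neg_one {t : ℝ} (ht : 1 ≤ t) :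
    HasDerivAt Real.log (t ^ (-1 : ℝ)) t := by
  rw [Real.rpow_neg_one]
  exact Real.hasDerivAt_log (by linarith)

/-- The propagation radius for `α > 1`. It stays below `1 / (α - 1)`, so the wave never leaves a
fixed ball. -/
theorem hasDerivAt_one_sub_rpow_div {α : ℝ} (hα : 1 < α) {t : ℝ} (ht : 1 ≤ t) :
    HasDerivAt (fun s : ℝ => (1 - s ^ (1 - α)) / (α - 1)) (t ^ (-α)) t := by
  have h1 : HasDerivAt (fun s : ℝ => s ^ (1 - α)) ((1 - α) * t ^ (1 - α - 1)) t :=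
    Real.hasDerivAt_rpow_const (Or.inl (by linarith))
  refine ((h1.const_sub 1).div_const (α - 1)).congr_deriv ?_
  have : α - 1 ≠ 0 := by linarith
  rw [show 1 - α - 1 = -α by ring]
  field_simp
  ring

section Lifespan

variable {n : ℕ} {α μ p R : ℝ} {u₀ u₁ : EuclideanSpace ℝ (Fin n) → ℝ}

/-- If the lifespan exceeds `s > 2`, then the data are small compared with the volume reached by
the wave up to time `s`. -/
theorem sq_le_of_lt_lifespan (hp : 1 < p) (hR : 0 < R) (hα : 0 ≤ α) (hμ : 0 ≤ μ)
    (hu₀_nonneg : ∀ x, 0 ≤ u₀ x) (hu₁_nonneg : ∀ x, 0 ≤ u₁ x) (hI : 0 < ∫ x, u₀ x)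
    (hu₀_supp : tsupport u₀ ⊆ Metric.closedBall 0 R)
    (hu₁_supp : tsupport u₁ ⊆ Metric.closedBall 0 R)
    {A : ℝ → ℝ} (hA : ∀ t, 1 ≤ t → HasDerivAt A (t ^ (-α)) t) (hA1 : A 1 = 0) :
    ∃ C : ℝ, 0 < C ∧ ∀ ε s B : ℝ, 0 < ε → 2 < s → (∀ t ∈ Icc 1 s, A t ≤ B) →
      (s : EReal) < lifespan (IsPowerSolution α μ p ε u₀ u₁) →
      s ^ 2 ≤ C * (R + B) ^ (n * (p - 1)) * ε ^ (-(p - 1)) := by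
  set V := volume.real (Metric.ball (0 : EuclideanSpace ℝ (Fin n)) 1) with hV
  have hVpos : 0 < V :=
    ENNReal.toReal_pos (Metric.measure_ball_pos volume _ one_pos).ne' measure_ball_lt_top.ne
  set Q : ℝ := 2 ^ (μ + 1) / (1 - 2 ^ (-((p - 1) / 2))) ^ 2 with hQ
  have hQpos : 0 < Q := by
    have : (2 : ℝ) ^ (-((p - 1) / 2)) < 1 :=
      Real.rpow_lt_one_of_one_lt_of_neg (by norm_num) (by linarith)
    have h2 : 0 < 1 - (2 : ℝ) ^ (-((p - 1) / 2)) := by linarith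
    positivity
  set I := ∫ x, u₀ x with hIdef
  -- The factor `4` comes from taking `a = s / 2`; the powers of `V` and `I` are moved over from the
  -- left side of the mean bound.
  refine ⟨4 * Q * V ^ (p - 1) * I ^ (-(p - 1)), by positivity, fun ε s B hε hs hB hlt => ?_⟩
  obtain ⟨T, ⟨u, hu⟩, hsT⟩ := lt_sSup_iff.1 hlt
  -- The existence time may be infinite, so the solution is restricted to a real endpoint beyond
  -- `s`.
  obtain ⟨T', h1, h2⟩ := EReal.lt_iff_exists_real_btwn.1 hsT
  have hsT' : s < T' := by exact_mod_cast h1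
  have hsol : IsPowerSolution α μ p ε u₀ u₁ (T' : EReal) u :=
    IsClassicalSolution.mono hu (by exact_mod_cast (by linarith : (1 : ℝ) < T')) h2.le
  have hs2 : 2 * (s / 2) = s := by ring
  have hB0 : 0 ≤ B := hA1 ▸ hB 1 ⟨le_rfl, by linarith⟩
  have hRB : 0 < R + B := by linarith
  have key := hsol.mean_bound hp hR hε hα hμ hu₀_nonneg hu₁_nonneg hI hu₀_supp hu₁_supp hA hA1
    (a := s / 2) (B := B) (by linarith) (by rwa [hs2]) (by rwa [hs2])
  rw [Measure.addHaar_real_closedBall _ _ hRB.le, finrank_euclideanSpace_fin, ← hV, ← hQ,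
    Real.mul_rpow (by positivity) hVpos.le, Real.mul_rpow hε.le hI.le, ← Real.rpow_natCast,
    ← Real.rpow_mul hRB.le] at key
  have e1 : (R + B) ^ (n * (p - 1)) * (R + B) ^ (n * (1 - p)) = 1 := by
    rw [← Real.rpow_add hRB, ← Real.rpow_zero (R + B)]
    congr 1
    ring
  have e2 : V ^ (p - 1) * V ^ (1 - p) = 1 := by
    rw [← Real.rpow_add hVpos, ← Real.rpow_zero V]
    congr 1
    ring
  have e3 : I ^ (-(p - 1)) * I ^ (p - 1) = 1 := by
    rw [← Real.rpow_add hI, neg_add_cancel, Real.rpow_zero]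
  have e4 : ε ^ (-(p - 1)) * ε ^ (p - 1) = 1 := by
    rw [← Real.rpow_add hε, neg_add_cancel, Real.rpow_zero]
  calc s ^ 2 = 4 * ((R + B) ^ (n * (p - 1)) * (R + B) ^ (n * (1 - p))) *
        (V ^ (p - 1) * V ^ (1 - p)) * (I ^ (-(p - 1)) * I ^ (p - 1)) *
        (ε ^ (-(p - 1)) * ε ^ (p - 1)) * (s / 2) ^ 2 := by rw [e1, e2, e3, e4]; ring
    _ = 4 * (R + B) ^ (n * (p - 1)) * V ^ (p - 1) * I ^ (-(p - 1)) * ε ^ (-(p - 1)) *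
        ((R + B) ^ (n * (1 - p)) * V ^ (1 - p) * (ε ^ (p - 1) * I ^ (p - 1)) * (s / 2) ^ 2) := by
      ring
    _ ≤ 4 * (R + B) ^ (n * (p - 1)) * V ^ (p - 1) * I ^ (-(p - 1)) * ε ^ (-(p - 1)) * Q := by
      gcongr
    _ = _ := by ring

/-- The lifespan bound for integrable propagation speed. -/
theorem exists_lifespan_le_of_one_lt (hp : 1 < p) (hR : 0 < R) (hα : 1 < α) (hμ : 0 ≤ μ)
    (hu₀_nonneg : ∀ x, 0 ≤ u₀ x) (hu₁_nonneg : ∀ x, 0 ≤ u₁ x) (hI : 0 < ∫ x, u₀ x)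
    (hu₀_supp : tsupport u₀ ⊆ Metric.closedBall 0 R)
    (hu₁_supp : tsupport u₁ ⊆ Metric.closedBall 0 R) :
    ∃ C : ℝ, 0 < C ∧ ∀ ε : ℝ, 0 < ε →
      lifespan (IsPowerSolution α μ p ε u₀ u₁)
        ≤ ((max 2 (C * ε ^ (-(p - 1) / 2)) : ℝ) : EReal) := by
  obtain ⟨C, hC, hle⟩ := sq_le_of_lt_lifespan (α := α) hp hR (by linarith) hμ hu₀_nonneg hu₁_nonneg
    hI hu₀_supp hu₁_supp (fun t ht => hasDerivAt_one_sub_rpow_div hα ht) (by simp)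
  have hRB : 0 < R + 1 / (α - 1) := by
    have : 0 < α - 1 := by linarith
    positivity
  set D := C * (R + 1 / (α - 1)) ^ (n * (p - 1)) with hD
  have hD0 : 0 < D := by positivity
  refine ⟨√D, Real.sqrt_pos.2 hD0, fun ε hε => ?_⟩
  by_contra! hlt
  obtain ⟨s, h1, h2⟩ := EReal.lt_iff_exists_real_btwn.1 hlt
  have h1' : max 2 (√D * ε ^ (-(p - 1) / 2)) < s := by exact_mod_cast h1
  obtain ⟨hs2, hsD⟩ := max_lt_iff.1 h1'
  have h3 := hle ε s (1 / (α - 1)) hε hs2 (fun t ht => by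
    have := Real.rpow_nonneg (zero_le_one.trans ht.1) (1 - α)
    have h4 : 0 < α - 1 := by linarith
    gcongr
    linarith) h2
  have h4 : (√D * ε ^ (-(p - 1) / 2)) ^ 2 = D * ε ^ (-(p - 1)) := by
    rw [mul_pow, Real.sq_sqrt hD0.le, ← Real.rpow_natCast, ← Real.rpow_mul hε.le]
    congr 2
    push_cast
    ring
  have h5 : (√D * ε ^ (-(p - 1) / 2)) ^ 2 < s ^ 2 :=
    pow_lt_pow_left₀ hsD (by positivity) two_ne_zero
  rw [h4] at h5
  linarith

/-- The implicit lifespan bound for the propagation speed `1/t`. -/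
theorem exists_sq_le_of_lt_lifespan_one (hp : 1 < p) (hR : 0 < R) (hμ : 0 ≤ μ)
    (hu₀_nonneg : ∀ x, 0 ≤ u₀ x) (hu₁_nonneg : ∀ x, 0 ≤ u₁ x) (hI : 0 < ∫ x, u₀ x)
    (hu₀_supp : tsupport u₀ ⊆ Metric.closedBall 0 R)
    (hu₁_supp : tsupport u₁ ⊆ Metric.closedBall 0 R) :
    ∃ C : ℝ, 0 < C ∧ ∀ ε s : ℝ, 0 < ε → 2 < s →
      (s : EReal) < lifespan (IsPowerSolution 1 μ p ε u₀ u₁) →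
      s ^ 2 ≤ C * (R + Real.log s) ^ (n * (p - 1)) * ε ^ (-(p - 1)) := by
  obtain ⟨C, hC, hle⟩ := sq_le_of_lt_lifespan (α := 1) hp hR zero_le_one hμ hu₀_nonneg hu₁_nonneg
    hI hu₀_supp hu₁_supp (fun t ht => hasDerivAt_log_rpow_neg_one ht) Real.log_one
  exact ⟨C, hC, fun ε s hε hs hlt => hle ε s _ hε hs
    (fun t ht => Real.log_le_log (by linarith [ht.1]) ht.2) hlt⟩

end Lifespan

/-- Powers of the logarithm are negligible against `s ^ 2`. This turns the implicit bound for `α =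
1` into finiteness of the lifespan. -/
theorem exists_lt_sq_of_log (C R m : ℝ) (hm : 0 ≤ m) (hR : 0 ≤ R) :
    ∃ S : ℝ, ∀ s : ℝ, S ≤ s → C * (R + Real.log s) ^ m < s ^ 2 := by
  -- The small constant is chosen so that the final bound is `s ^ 2 / 2`; the `2 ^ m` pays for `R +
  -- log s ≤ 2 log s`, valid once `R ≤ log s`.
  have h1 := (isLittleO_log_rpow_rpow_atTop m (show (0 : ℝ) < 2 by norm_num)).def
    (show (0 : ℝ) < 1 / (2 * ((|C| + 1) * 2 ^ m)) by positivity)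
  have h2 : ∀ᶠ s in atTop, C * (R + Real.log s) ^ m < s ^ 2 := by
    filter_upwards [h1, Real.tendsto_log_atTop.eventually_ge_atTop R, eventually_gt_atTop 1]
      with s hs hRs hs1
    have hl : 0 < Real.log s := Real.log_pos hs1
    rw [Real.norm_of_nonneg (Real.rpow_nonneg hl.le m),
      Real.norm_of_nonneg (by positivity : 0 ≤ s ^ (2 : ℝ)), Real.rpow_two] at hs
    have h3 : (R + Real.log s) ^ m ≤ 2 ^ m * Real.log s ^ m := by
      rw [← Real.mul_rpow (by norm_num) hl.le]
      exact Real.rpow_le_rpow (by linarith) (by linarith) hm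
    calc C * (R + Real.log s) ^ m ≤ (|C| + 1) * (2 ^ m * Real.log s ^ m) :=
          mul_le_mul (by linarith [le_abs_self C]) h3 (Real.rpow_nonneg (by linarith) _)
            (by positivity)
      _ ≤ (|C| + 1) * (2 ^ m * (1 / (2 * ((|C| + 1) * 2 ^ m)) * s ^ 2)) := by gcongr
      _ = s ^ 2 / 2 := by field_simp
      _ < s ^ 2 := by have : 0 < s ^ 2 := by positivity
                      linarith
  exact eventually_atTop.1 h2

section PowerLaw

variable {n : ℕ} {α μ p R : ℝ} {u₀ u₁ : EuclideanSpace ℝ (Fin n) → ℝ}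

theorem lifespan_one_lt_top (hp : 1 < p) (hR : 0 < R) (hμ : 0 ≤ μ)
    (hu₀_nonneg : ∀ x, 0 ≤ u₀ x) (hu₁_nonneg : ∀ x, 0 ≤ u₁ x) (hI : 0 < ∫ x, u₀ x)
    (hu₀_supp : tsupport u₀ ⊆ Metric.closedBall 0 R)
    (hu₁_supp : tsupport u₁ ⊆ Metric.closedBall 0 R) {ε : ℝ} (hε : 0 < ε) :
    lifespan (IsPowerSolution 1 μ p ε u₀ u₁) < ⊤ := by
  obtain ⟨C, hC, hle⟩ := exists_sq_le_of_lt_lifespan_one (n := n) hp hR hμ hu₀_nonneg hu₁_nonneg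
    hI hu₀_supp hu₁_supp
  obtain ⟨S, hS⟩ := exists_lt_sq_of_log (C * ε ^ (-(p - 1))) R (n * (p - 1))
    (mul_nonneg n.cast_nonneg (by linarith)) hR.le
  by_contra hcon
  rw [not_lt_top_iff] at hcon
  have h1 := hle ε (max S 3) hε (lt_of_lt_of_le (by norm_num) (le_max_right _ _))
    (hcon ▸ EReal.coe_lt_top _)
  have h2 := hS (max S 3) (le_max_left _ _)
  linarith

/-- The lower bound `T₀ > 1` keeps `log` of the lifespan away from zero, so that `R + log` is
comparable to `log` alone. -/
theorem exists_lifespan_one_bound (hp : 1 < p) (hR : 0 < R) (hμ : 0 ≤ μ)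
    (hu₀_nonneg : ∀ x, 0 ≤ u₀ x) (hu₁_nonneg : ∀ x, 0 ≤ u₁ x) (hI : 0 < ∫ x, u₀ x)
    (hu₀_supp : tsupport u₀ ⊆ Metric.closedBall 0 R)
    (hu₁_supp : tsupport u₁ ⊆ Metric.closedBall 0 R) {T₀ : ℝ} (hT₀ : 1 < T₀) :
    ∃ C : ℝ, 0 < C ∧ ∀ ε : ℝ, 0 < ε → ε ≤ 1 →
      (T₀ : EReal) ≤ lifespan (IsPowerSolution 1 μ p ε u₀ u₁) →
      (lifespan (IsPowerSolution 1 μ p ε u₀ u₁)).toReal ^ 2 *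
        Real.log (lifespan (IsPowerSolution 1 μ p ε u₀ u₁)).toReal ^ (-(n * (p - 1)))
        ≤ C * ε ^ (-(p - 1)) := by
  obtain ⟨C, hC, hle⟩ := exists_sq_le_of_lt_lifespan_one (n := n) hp hR hμ hu₀_nonneg hu₁_nonneg
    hI hu₀_supp hu₁_supp
  set m : ℝ := n * (p - 1) with hm
  have hm0 : 0 ≤ m := mul_nonneg n.cast_nonneg (by linarith)
  have hl0 : 0 < Real.log T₀ := Real.log_pos hT₀
  -- The first summand serves lifespans above `2`, the second those up to `2`, where `ℓ ^ 2 ≤ 4` and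
  -- `ε ^ (-(p - 1)) ≥ 1`.
  refine ⟨C * (R / Real.log T₀ + 1) ^ m + 4 * Real.log T₀ ^ (-m), by positivity,
    fun ε hε hε1 hT => ?_⟩
  have hfin := lifespan_one_lt_top hp hR hμ hu₀_nonneg hu₁_nonneg hI hu₀_supp hu₁_supp hε
  set L := lifespan (IsPowerSolution 1 μ p ε u₀ u₁) with hL
  -- With no solution at all the supremum would be `⊥`, which `T₀ ≤ L` excludes; hence `L` is a real
  -- number.
  have hbot : L ≠ ⊥ := fun h => by
    rw [h] at hT
    exact EReal.coe_ne_bot _ (le_bot_iff.1 hT)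
  set ℓ := L.toReal with hℓ
  have hLℓ : (ℓ : EReal) = L := EReal.coe_toReal hfin.ne hbot
  rw [← hLℓ] at hT
  have hT₀ℓ : T₀ ≤ ℓ := by exact_mod_cast hT
  have hlog : Real.log T₀ ≤ Real.log ℓ := Real.log_le_log (by linarith) hT₀ℓ
  have hlogpos : 0 < Real.log ℓ := hl0.trans_le hlog
  have hε2 : 1 ≤ ε ^ (-(p - 1)) :=
    Real.one_le_rpow_of_pos_of_le_one_of_nonpos hε hε1 (by linarith)
  have hlogm : 0 < Real.log ℓ ^ (-m) := Real.rpow_pos_of_pos hlogpos _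
  rcases le_or_gt ℓ 2 with h2 | h2
  · have h3 : Real.log ℓ ^ (-m) ≤ Real.log T₀ ^ (-m) :=
      Real.rpow_le_rpow_of_nonpos hl0 hlog (by linarith)
    calc ℓ ^ 2 * Real.log ℓ ^ (-m) ≤ 2 ^ 2 * Real.log T₀ ^ (-m) := by
          gcongr
          linarith
      _ = 4 * Real.log T₀ ^ (-m) * 1 := by ring
      _ ≤ (C * (R / Real.log T₀ + 1) ^ m + 4 * Real.log T₀ ^ (-m)) * ε ^ (-(p - 1)) := by
          gcongr
          have : 0 < C * (R / Real.log T₀ + 1) ^ m := by positivity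
          linarith
  · set f := C * (R + Real.log ℓ) ^ m * ε ^ (-(p - 1)) with hf
    have hf0 : 0 ≤ f := by positivity
    -- The implicit bound is known only for `s` strictly below the lifespan; a violation at `ℓ`
    -- would give one at some `s` between `√f` and `ℓ`.
    have hℓf : ℓ ^ 2 ≤ f := by
      by_contra! hcon
      have h3 : √f < ℓ := (Real.sqrt_lt' (by linarith)).2 hcon
      obtain ⟨s, h4, h5⟩ := exists_between (max_lt h2 h3)
      obtain ⟨h6, h7⟩ := max_lt_iff.1 h4
      have h8 := hle ε s hε h6 (by rw [← hL, ← hLℓ]; exact_mod_cast h5)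
      have h9 : Real.log s ≤ Real.log ℓ := Real.log_le_log (by linarith) h5.le
      have h10 : 0 ≤ Real.log s := Real.log_nonneg (by linarith)
      have h11 : C * (R + Real.log s) ^ m * ε ^ (-(p - 1)) ≤ f := by
        rw [hf]
        gcongr
      have h12 : f < s ^ 2 := (Real.sqrt_lt' (by linarith)).1 h7
      linarith
    have h3 : R + Real.log ℓ ≤ (R / Real.log T₀ + 1) * Real.log ℓ := by
      have : R ≤ R / Real.log T₀ * Real.log ℓ := by
        rw [div_mul_eq_mul_div, le_div_iff₀ hl0]
        gcongr
      linarith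
    have h4 : (R + Real.log ℓ) ^ m ≤ (R / Real.log T₀ + 1) ^ m * Real.log ℓ ^ m := by
      rw [← Real.mul_rpow (by positivity) hlogpos.le]
      gcongr
    have h5 : Real.log ℓ ^ m * Real.log ℓ ^ (-m) = 1 := by
      rw [← Real.rpow_add hlogpos, add_neg_cancel, Real.rpow_zero]
    calc ℓ ^ 2 * Real.log ℓ ^ (-m)
        ≤ C * ((R / Real.log T₀ + 1) ^ m * Real.log ℓ ^ m) * ε ^ (-(p - 1)) *
          Real.log ℓ ^ (-m) := by
          gcongr
          refine hℓf.trans ?_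
          rw [hf]
          gcongr
      _ = C * (R / Real.log T₀ + 1) ^ m * ε ^ (-(p - 1)) *
          (Real.log ℓ ^ m * Real.log ℓ ^ (-m)) := by ring
      _ = C * (R / Real.log T₀ + 1) ^ m * ε ^ (-(p - 1)) := by rw [h5, mul_one]
      _ ≤ _ := by
          gcongr
          have : 0 < Real.log T₀ ^ (-m) := by positivity
          linarith

theorem powerSolution_lifespan (hp : 1 < p) (hR : 0 < R) (hα : 1 ≤ α) (hμ : 0 ≤ μ)
    (hu₀_nonneg : ∀ x, 0 ≤ u₀ x) (hu₁_nonneg : ∀ x, 0 ≤ u₁ x) (hI : 0 < ∫ x, u₀ x)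
    (hu₀_supp : tsupport u₀ ⊆ Metric.closedBall 0 R)
    (hu₁_supp : tsupport u₁ ⊆ Metric.closedBall 0 R) :
    (∀ ε : ℝ, 0 < ε →
      (∀ T u, IsPowerSolution α μ p ε u₀ u₁ T u → T < ⊤) ∧
      lifespan (IsPowerSolution α μ p ε u₀ u₁) < ⊤) ∧
    ∃ ε₀ : ℝ, 0 < ε₀ ∧
      (α = 1 → ∀ T₀ : ℝ, 1 < T₀ → ∃ C : ℝ, 0 < C ∧ ∀ ε : ℝ, 0 < ε → ε ≤ ε₀ →
        (T₀ : EReal) ≤ lifespan (IsPowerSolution α μ p ε u₀ u₁) →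
        (lifespan (IsPowerSolution α μ p ε u₀ u₁)).toReal ^ 2 *
            Real.log (lifespan (IsPowerSolution α μ p ε u₀ u₁)).toReal ^ (-(n * (p - 1)))
          ≤ C * ε ^ (-(p - 1))) ∧
      (1 < α → ∃ C : ℝ, 0 < C ∧ ∀ ε : ℝ, 0 < ε → ε ≤ ε₀ →
        lifespan (IsPowerSolution α μ p ε u₀ u₁)
          ≤ ((C * ε ^ (-(p - 1) / 2) : ℝ) : EReal)) := by
  have hfin : ∀ ε : ℝ, 0 < ε → lifespan (IsPowerSolution α μ p ε u₀ u₁) < ⊤ := by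
    intro ε hε
    rcases hα.eq_or_lt with rfl | hα
    · exact lifespan_one_lt_top hp hR hμ hu₀_nonneg hu₁_nonneg hI hu₀_supp hu₁_supp hε
    · obtain ⟨C, -, hle⟩ := exists_lifespan_le_of_one_lt hp hR hα hμ hu₀_nonneg hu₁_nonneg hI
        hu₀_supp hu₁_supp
      exact (hle ε hε).trans_lt (EReal.coe_lt_top _)
  refine ⟨fun ε hε => ⟨fun T u hu => ?_, hfin ε hε⟩, 1, one_pos, ?_, fun hα => ?_⟩
  · exact (le_sSup (show T ∈ {T : EReal | ∃ u, IsPowerSolution α μ p ε u₀ u₁ T u} from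
      ⟨u, hu⟩)).trans_lt (hfin ε hε)
  · rintro rfl T₀ hT₀
    exact exists_lifespan_one_bound hp hR hμ hu₀_nonneg hu₁_nonneg hI hu₀_supp hu₁_supp hT₀
  · obtain ⟨C, hC, hle⟩ := exists_lifespan_le_of_one_lt hp hR hα hμ hu₀_nonneg hu₁_nonneg hI
      hu₀_supp hu₁_supp
    -- For `ε ≤ 1` the power of `ε` is at least `1`, so the threshold `2` is absorbed into the
    -- constant.
    refine ⟨max 2 C, by positivity, fun ε hε hε1 => (hle ε hε).trans ?_⟩
    have h1 : 1 ≤ ε ^ (-(p - 1) / 2) :=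
      Real.one_le_rpow_of_pos_of_le_one_of_nonpos hε hε1 (by linarith)
    have h2 : max 2 (C * ε ^ (-(p - 1) / 2)) ≤ max 2 C * ε ^ (-(p - 1) / 2) := by
      refine max_le ?_ (by gcongr; exact le_max_right _ _)
      calc (2 : ℝ) = 2 * 1 := by norm_num
        _ ≤ max 2 C * ε ^ (-(p - 1) / 2) := by
          gcongr
          exact le_max_left _ _
    exact_mod_cast h2

end PowerLaw

/-! ### Reduction of the FLRW equation and conclusion. -/

/-- The FLRW problem is the power-law problem with `α = 2 / (n (1 + w))` and `μ = 2 / (1 + w)`. -/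
theorem isFLRWSolution_eq_isPowerSolution {n : ℕ} (w p ε : ℝ)
    (u₀ u₁ : EuclideanSpace ℝ (Fin n) → ℝ) :
    IsFLRWSolution w p ε u₀ u₁ =
      IsPowerSolution (2 / (n * (1 + w))) (2 / (1 + w)) p ε u₀ u₁ := by
  funext T u
  have h1 : 2 * (2 / (n * (1 + w))) = 4 / (n * (1 + w)) := by ring
  simp only [IsFLRWSolution, IsPowerSolution, h1, div_div]

theorem theorem1p1 (n : ℕ) (hn : 2 ≤ n) (p : ℝ) (hp : 1 < p)
    (R : ℝ) (hR : 0 < R) (u₀ u₁ : EuclideanSpace ℝ (Fin n) → ℝ)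
    (hu₀ : ContDiff ℝ 2 u₀) (hu₁ : ContDiff ℝ 1 u₁)
    (hu₀_nonneg : ∀ x, 0 ≤ u₀ x) (hu₁_nonneg : ∀ x, 0 ≤ u₁ x)
    (hu₀_ne : u₀ ≠ 0) (hu₁_ne : u₁ ≠ 0)
    (hu₀_supp : tsupport u₀ ⊆ Metric.closedBall 0 R)
    (hu₁_supp : tsupport u₁ ⊆ Metric.closedBall 0 R) :
    (∀ α μ : ℝ, 1 ≤ α → 0 ≤ μ →
      (∀ ε : ℝ, 0 < ε →
        (∀ T u, IsPowerSolution α μ p ε u₀ u₁ T u → T < ⊤) ∧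
        lifespan (IsPowerSolution α μ p ε u₀ u₁) < ⊤) ∧
      ∃ ε₀ : ℝ, 0 < ε₀ ∧
        (α = 1 → ∀ T₀ : ℝ, 1 < T₀ → ∃ C : ℝ, 0 < C ∧ ∀ ε : ℝ, 0 < ε → ε ≤ ε₀ →
          (T₀ : EReal) ≤ lifespan (IsPowerSolution α μ p ε u₀ u₁) →
          (lifespan (IsPowerSolution α μ p ε u₀ u₁)).toReal ^ 2 *
              Real.log (lifespan (IsPowerSolution α μ p ε u₀ u₁)).toReal ^ (-(n * (p - 1)))
            ≤ C * ε ^ (-(p - 1))) ∧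
        (1 < α → ∃ C : ℝ, 0 < C ∧ ∀ ε : ℝ, 0 < ε → ε ≤ ε₀ →
          lifespan (IsPowerSolution α μ p ε u₀ u₁)
            ≤ ((C * ε ^ (-(p - 1) / 2) : ℝ) : EReal))) ∧
    (∀ w : ℝ, -1 < w → w ≤ 2 / n - 1 →
      (∀ ε : ℝ, 0 < ε →
        (∀ T u, IsFLRWSolution w p ε u₀ u₁ T u → T < ⊤) ∧
        lifespan (IsFLRWSolution w p ε u₀ u₁) < ⊤) ∧
      ∃ ε₀ : ℝ, 0 < ε₀ ∧
        (w = 2 / n - 1 → ∀ T₀ : ℝ, 1 < T₀ → ∃ C : ℝ, 0 < C ∧ ∀ ε : ℝ, 0 < ε → ε ≤ ε₀ →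
          (T₀ : EReal) ≤ lifespan (IsFLRWSolution w p ε u₀ u₁) →
          (lifespan (IsFLRWSolution w p ε u₀ u₁)).toReal ^ 2 *
              Real.log (lifespan (IsFLRWSolution w p ε u₀ u₁)).toReal ^ (-(n * (p - 1)))
            ≤ C * ε ^ (-(p - 1))) ∧
        (w < 2 / n - 1 → ∃ C : ℝ, 0 < C ∧ ∀ ε : ℝ, 0 < ε → ε ≤ ε₀ →
          lifespan (IsFLRWSolution w p ε u₀ u₁)
            ≤ ((C * ε ^ (-(p - 1) / 2) : ℝ) : EReal))) := by

  obtain ⟨x, hx⟩ := Function.ne_iff.1 hu₀_ne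
  have hI : 0 < ∫ x, u₀ x :=
    hu₀.continuous.integral_pos_of_hasCompactSupport_nonneg_nonzero
      ((isCompact_closedBall 0 R).of_isClosed_subset (isClosed_tsupport u₀) hu₀_supp)
      hu₀_nonneg hx
  refine ⟨fun α μ hα hμ => powerSolution_lifespan hp hR hα hμ hu₀_nonneg hu₁_nonneg hI
    hu₀_supp hu₁_supp, fun w hw hw' => ?_⟩
  have hn0 : (0 : ℝ) < n := by exact_mod_cast (by omega : 0 < n)
  have hw0 : 0 < 1 + w := by linarith
  -- The condition `w ≤ 2 / n - 1` says exactly that the FLRW exponent is at least `1`, with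
  -- equality in the borderline case.
  have hα : 1 ≤ 2 / (n * (1 + w)) := by
    rw [one_le_div (by positivity), mul_comm, ← le_div_iff₀ hn0]
    linarith
  obtain ⟨h1, ε₀, hε₀, h2, h3⟩ := powerSolution_lifespan hp hR hα
    (by positivity : 0 ≤ 2 / (1 + w)) hu₀_nonneg hu₁_nonneg hI hu₀_supp hu₁_supp
  simp only [isFLRWSolution_eq_isPowerSolution]
  refine ⟨h1, ε₀, hε₀, fun hw1 => h2 ?_, fun hw1 => h3 ?_⟩
  · rw [hw1]
    field_simp
    ring
  · rw [one_lt_div (by positivity), mul_comm, ← lt_div_iff₀ hn0]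
    linarith
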